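/- All graphs are finite and simple. A \emph{geometric intersection graph} is the intersection graph of a finite collection of distinct subsets of some $\mathbb{R}^n$. A class of graphs is \emph{hereditary} if it is closed under isomorphism and induced subgraphs, and a hereditary class $\mathcal{C}$ is \emph{$\chi$-unbounded} if there is no function $f:\mathbb{N}\to\mathbb{N}$ with $\chi(G)\le f(\omega(G))$ for all $G\in\mathcal{C}$. For $d\ge 1$, a \emph{$d$-CBU graph} is the intersection graph of a finite family of closed axis-parallel boxes with non-empty interior in $\mathbb{R}^d$ such that the intersection of any two distinct boxes lies in a hyperplane perpendicular to $e_1$; a \emph{CBU graph} is a graph that is $d$-CBU for some $d\ge 1$. A \emph{frame} is the border of an axis-aligned rectangle with non-empty interior in $\mathbb{R}^2$. A \emph{Burling graph} is a triangle-free intersection graph of a finite set of frames such that (i) the left side of any frame does not intersect any other frame, and if the right side of a frame intersects another frame, then it intersects both the top and the bottom side of that other frame; (ii) if two frames intersect, then no third frame is contained in the intersection of the regions bounded by the two; (iii) if one frame lies entirely in the interior of another and both intersect a third frame $F$, then they intersect only the top and bottom sides of $F$ (not its left or right side). A \emph{wheel} is a graph consisting of an induced cycle of length at least $4$ and one further vertex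 with at least three neighbours on the cycle. \textbf{Theorem.} For every $d\ge 3$, the class of $d$-CBU graphs is a hereditary class of geometric intersection graphs that is triangle-free and $\chi$-unbounded, and it neither contains nor is contained in the class of Burling graphs. Indeed, there is a wheel $G_1$ that is a $2$-CBU graph but not a Burling graph, and there is a Burling graph $G_2$ that is not a CBU graph. For $d\ne d'$ with $d,d'\ge 3$, the classes of $d$-CBU graphs and of $d'$-CBU graphs are distinct. Consequently, there are infinitely many hereditary, triangle-free, $\chi$-unbounded classes of geometric intersection graphs that neither contain nor are contained in the class of Burling graphs. -/

import Mathlib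

/-- A finite simple graph. -/
structure FiniteGraph : Type 1 where
  V : Type
  finite : Finite V
  graph : SimpleGraph V

/-- A class of finite simple graphs. -/
abbrev GraphClass : Type 1 := Set FiniteGraph

/-- A class of graphs is hereditary if it is closed under induced subgraphs (and isomorphism). -/
def IsHereditary (C : GraphClass) : Prop :=
  ∀ G H : FiniteGraph, G ∈ C → Nonempty (H.graph ↪g G.graph) → H ∈ C

/-- All graphs of the class are triangle-free. -/
def IsTriangleFreeClass (C : GraphClass) : Prop :=
  ∀ G ∈ C, G.graph.CliqueFree 3

/-- The bound that defines χ-boundedness: `χ(G) ≤ f(ω(G))` for all `G` in the class. -/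
def IsChiBounded (C : GraphClass) : Prop :=
  ∃ f : ℕ → ℕ, ∀ G ∈ C, G.graph.chromaticNumber ≤ (f G.graph.cliqueNum : ℕ∞)

/-- A class that is not χ-bounded. -/
def IsChiUnbounded (C : GraphClass) : Prop := ¬ IsChiBounded C

/-- `G` is the intersection graph of the sets `S v`, with the vertex `v` standing for `S v`
(distinct vertices stand for distinct sets). -/
def IsIntersectionGraphOf {V X : Type} (G : SimpleGraph V) (S : V → Set X) : Prop :=
  Function.Injective S ∧ ∀ u v : V, G.Adj u v ↔ u ≠ v ∧ (S u ∩ S v).Nonempty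

/-- Every graph of the class is an intersection graph of subsets of some `ℝⁿ`. -/
def IsGeometricClass (C : GraphClass) : Prop :=
  ∀ G ∈ C, ∃ (n : ℕ) (S : G.V → Set (Fin n → ℝ)), IsIntersectionGraphOf G.graph S

/-- `d`-CBU graphs: intersection graphs of axis-parallel (closed, full-dimensional) boxes in `ℝᵈ`,
`d ≥ 1`, in which any two distinct boxes meet inside a hyperplane perpendicular to the first
basis vector. -/
def IsDCBU (d : ℕ) {V : Type} (G : SimpleGraph V) : Prop :=
  ∃ (hd : 0 < d) (B : V → BoxIntegral.Box (Fin d)),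
    IsIntersectionGraphOf G (fun v => BoxIntegral.Box.Icc (B v)) ∧
    ∀ u v : V, u ≠ v →
      ∃ c : ℝ, BoxIntegral.Box.Icc (B u) ∩ BoxIntegral.Box.Icc (B v) ⊆
        {x : Fin d → ℝ | x ⟨0, hd⟩ = c}

/-- The class of `d`-CBU graphs. -/
def dCBUGraphs (d : ℕ) : GraphClass := {G | IsDCBU d G.graph}

/-- The class of CBU graphs: those that are `d`-CBU for some `d ≥ 1`. -/
def CBUGraphs : GraphClass := {G | ∃ d : ℕ, 1 ≤ d ∧ G ∈ dCBUGraphs d}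

/-- The data of a frame, the border of the rectangle `[x₁, x₂] × [y₁, y₂]` with non-empty
interior. -/
structure Frame where
  x₁ : ℝ
  x₂ : ℝ
  y₁ : ℝ
  y₂ : ℝ
  hx : x₁ < x₂
  hy : y₁ < y₂

namespace Frame

def left (F : Frame) : Set (ℝ × ℝ) := {F.x₁} ×ˢ Set.Icc F.y₁ F.y₂

def right (F : Frame) : Set (ℝ × ℝ) := {F.x₂} ×ˢ Set.Icc F.y₁ F.y₂

def bottom (F : Frame) : Set (ℝ × ℝ) := Set.Icc F.x₁ F.x₂ ×ˢ {F.y₁}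

def top (F : Frame) : Set (ℝ × ℝ) := Set.Icc F.x₁ F.x₂ ×ˢ {F.y₂}

/-- The frame as a curve in the plane. -/
def border (F : Frame) : Set (ℝ × ℝ) := F.left ∪ F.right ∪ F.bottom ∪ F.top

/-- The region bounded by the frame. -/
def region (F : Frame) : Set (ℝ × ℝ) := Set.Icc F.x₁ F.x₂ ×ˢ Set.Icc F.y₁ F.y₂

/-- The interior of the frame. -/
def inner (F : Frame) : Set (ℝ × ℝ) := Set.Ioo F.x₁ F.x₂ ×ˢ Set.Ioo F.y₁ F.y₂

end Frame

/-- The conditions on the frames that represent a Burling graph. -/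
structure IsBurlingFamily {V : Type} (F : V → Frame) : Prop where
  left_side : ∀ u v : V, u ≠ v → Disjoint (F u).left (F v).border
  right_side : ∀ u v : V, u ≠ v → ((F u).right ∩ (F v).border).Nonempty →
    ((F u).right ∩ (F v).top).Nonempty ∧ ((F u).right ∩ (F v).bottom).Nonempty
  no_third : ∀ u v w : V, u ≠ v → w ≠ u → w ≠ v →
    ((F u).border ∩ (F v).border).Nonempty →
    ¬ (F w).border ⊆ (F u).region ∩ (F v).region
  nested : ∀ u v w : V, u ≠ v → w ≠ u → w ≠ v → (F u).border ⊆ (F v).inner →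
    ((F u).border ∩ (F w).border).Nonempty → ((F v).border ∩ (F w).border).Nonempty →
    Disjoint ((F u).border ∪ (F v).border) ((F w).left ∪ (F w).right)

/-- Burling graphs, through representations by frames. -/
def IsBurling {V : Type} (G : SimpleGraph V) : Prop :=
  G.CliqueFree 3 ∧ ∃ F : V → Frame,
    IsIntersectionGraphOf G (fun v => (F v).border) ∧ IsBurlingFamily F

/-- The class of Burling graphs. -/
def burlingGraphs : GraphClass := {G | IsBurling G.graph}

/-- A wheel: an induced cycle of length at least four together with one further vertex that has
at least three neighbours on the cycle. -/
def IsWheel {V : Type} (G : SimpleGraph V) : Prop :=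
  ∃ (hub : V) (n : ℕ), 4 ≤ n ∧
    Nonempty (G.induce {v | v ≠ hub} ≃g SimpleGraph.cycleGraph n) ∧
    3 ≤ (G.neighborSet hub).ncard

/-!
A `d`-CBU representation restricts in the first coordinate to intervals `[l v, r v]` with
`r u = l v` or `r v = l u` for adjacent `u` and `v`, that is, to a homomorphism to a shift graph
(`isDCBU_iff`, `IsDCBU.exists_intervals`). Triangle-freeness is immediate from this.

*Large chromatic number.* For an acyclic digraph with large chromatic number, the graph of its arcs,
with consecutive arcs adjacent, also has large chromatic number, because the sets of colours of the
outgoing arcs colour the vertices. An arc `u v` is drawn as a box that begins at the time of `u` and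
ends at the time of `v`, so what has to be arranged is that boxes of non-consecutive arcs with
overlapping life spans are disjoint in the remaining two coordinates. Burling's recursive
construction of digraphs with probes (`ProbedDigraph.next`) admits such a drawing
(`ProbedDigraph.Drawing.next`): the vertices of a probe keep disjoint columns that cross the strip
of the probe, and every further arc is placed in such a column, within its own substrip.

*Comparison with Burling graphs.* In a Burling family two frames meet only by `Frame.Crosses`, which
orients the edges; the frames that cross a given one form a chain under nesting and the frames
crossed by it are pairwise not nested. Hence a square is always oriented from two opposite corners
to the other two, while an induced hexagon cannot be oriented alternately. The cube without a vertex
is a wheel whose three squares at the hub force an alternating hexagon, so it is not a Burling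
graph, although it is a contact graph of seven rectangles. Conversely, `burlingGraphNotCBU` is
represented by eight explicit frames but has no homomorphism to a shift graph.

*Dimensions.* Take a complete bipartite graph and delete a matching of size `n` that leaves one
vertex on each side unmatched (`crownWithApexes`). A coordinate separates at most one of the deleted
pairs in each of its two directions, and the two unmatched vertices prevent the first coordinate
from doing both. So `n ≤ 2 * d - 1` in a `d`-CBU graph, whereas `n = 2 * d` is attained in
dimension `d + 1`.
-/

/-! ### Boxes with unidirectional contacts -/

theorem Box.Icc_inter_Icc_nonempty_iff {d : ℕ} (B C : BoxIntegral.Box (Fin d)) :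
    (BoxIntegral.Box.Icc B ∩ BoxIntegral.Box.Icc C).Nonempty ↔
      ∀ i, B.lower i ≤ C.upper i ∧ C.lower i ≤ B.upper i := by
  constructor
  · rintro ⟨x, hB, hC⟩ i
    exact ⟨(hB.1 i).trans (hC.2 i), (hC.1 i).trans (hB.2 i)⟩
  · intro h
    refine ⟨fun i => max (B.lower i) (C.lower i), ⟨fun i => le_max_left _ _, fun i => ?_⟩,
      ⟨fun i => le_max_right _ _, fun i => ?_⟩⟩
    · exact max_le (B.lower_lt_upper i).le (h i).2
    · exact max_le (h i).1 (C.lower_lt_upper i).le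

/-- The coordinatewise description of `d`-CBU graphs: adjacency means overlap in every coordinate,
and of two adjacent boxes one ends, in the first coordinate, where the other begins. -/
theorem isDCBU_iff {d : ℕ} {V : Type} {G : SimpleGraph V} :
    IsDCBU d G ↔ ∃ (hd : 0 < d) (B : V → BoxIntegral.Box (Fin d)),
      (∀ u v, u ≠ v → (G.Adj u v ↔
        ∀ i, (B u).lower i ≤ (B v).upper i ∧ (B v).lower i ≤ (B u).upper i)) ∧
      ∀ u v, G.Adj u v →
        (B u).upper ⟨0, hd⟩ = (B v).lower ⟨0, hd⟩ ∨ (B v).upper ⟨0, hd⟩ = (B u).lower ⟨0, hd⟩ := by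
  constructor
  · rintro ⟨hd, B, ⟨-, hadj⟩, hc⟩
    have key : ∀ u v, u ≠ v → (G.Adj u v ↔
        ∀ i, (B u).lower i ≤ (B v).upper i ∧ (B v).lower i ≤ (B u).upper i) := by
      intro u v huv
      rw [hadj, Box.Icc_inter_Icc_nonempty_iff]
      simp [huv]
    refine ⟨hd, B, key, fun u v huv => ?_⟩
    obtain ⟨c, hc⟩ := hc u v huv.ne
    have hm := (key u v huv.ne).1 huv
    set o : Fin d := ⟨0, hd⟩ with ho
    -- Every value between the larger lower end and the smaller upper end occurs as the first
    -- coordinate of a common point, so there is only one such value.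
    have mem : ∀ t, max ((B u).lower o) ((B v).lower o) ≤ t →
        t ≤ min ((B u).upper o) ((B v).upper o) → t = c := by
      intro t h1 h2
      rw [max_le_iff] at h1
      rw [le_min_iff] at h2
      have : Function.update (fun i => max ((B u).lower i) ((B v).lower i)) o t ∈
          BoxIntegral.Box.Icc (B u) ∩ BoxIntegral.Box.Icc (B v) := by
        refine ⟨⟨fun i => ?_, fun i => ?_⟩, ⟨fun i => ?_, fun i => ?_⟩⟩ <;>
          rcases eq_or_ne i o with rfl | hi
        · simpa using h1.1
        · simp [hi]
        · simpa using h2.1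
        · simpa [hi] using ⟨(B u).lower_le_upper i, (hm i).2⟩
        · simpa using h1.2
        · simp [hi]
        · simpa using h2.2
        · simpa [hi] using ⟨(hm i).1, (B v).lower_le_upper i⟩
      simpa using hc this
    have hle : max ((B u).lower o) ((B v).lower o) ≤ min ((B u).upper o) ((B v).upper o) :=
      max_le (le_min ((B u).lower_lt_upper o).le (hm o).1)
        (le_min (hm o).2 ((B v).lower_lt_upper o).le)
    have heq := (mem _ le_rfl hle).trans (mem _ hle le_rfl).symm
    have hu := (B u).lower_lt_upper o
    have hv := (B v).lower_lt_upper o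
    rcases max_choice ((B u).lower o) ((B v).lower o) with h1 | h1 <;>
    rcases min_choice ((B u).upper o) ((B v).upper o) with h2 | h2 <;>
    rw [h1, h2] at heq
    · linarith
    · exact Or.inr heq.symm
    · exact Or.inl heq.symm
    · linarith
  · rintro ⟨hd, B, hadj, ht⟩
    have key : ∀ u v : V, G.Adj u v ↔ u ≠ v ∧
        (BoxIntegral.Box.Icc (B u) ∩ BoxIntegral.Box.Icc (B v)).Nonempty := by
      intro u v
      rw [Box.Icc_inter_Icc_nonempty_iff]
      exact ⟨fun h => ⟨h.ne, (hadj u v h.ne).1 h⟩, fun h => (hadj u v h.1).2 h.2⟩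
    refine ⟨hd, B, ⟨fun u v huv => ?_, key⟩, fun u v huv => ?_⟩
    · by_contra hne
      have huv : B u = B v := (BoxIntegral.Box.Icc).injective huv
      have h : G.Adj u v := (hadj u v hne).2 fun i => by
        rw [huv]; exact ⟨(B v).lower_le_upper i, (B v).lower_le_upper i⟩
      have := (B v).lower_lt_upper ⟨0, hd⟩
      rcases ht u v h with h | h <;> rw [huv] at h <;> linarith
    · by_cases h : G.Adj u v
      · rcases ht u v h with h | h
        · exact ⟨(B v).lower ⟨0, hd⟩, fun x hx => le_antisymm (h ▸ hx.1.2 _) (hx.2.1 _)⟩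
        · exact ⟨(B u).lower ⟨0, hd⟩, fun x hx => le_antisymm (h ▸ hx.2.2 _) (hx.1.1 _)⟩
      · refine ⟨0, fun x hx => absurd ((key u v).2 ⟨huv, x, hx⟩) h⟩

/-- The first coordinates of a box representation are a homomorphism to a shift graph. -/
theorem IsDCBU.exists_intervals {d : ℕ} {V : Type} {G : SimpleGraph V} (h : IsDCBU d G) :
    ∃ l r : V → ℝ, (∀ v, l v < r v) ∧ ∀ u v, G.Adj u v → r u = l v ∨ r v = l u := by
  obtain ⟨hd, B, -, ht⟩ := isDCBU_iff.1 h
  exact ⟨_, _, fun v => (B v).lower_lt_upper _, ht⟩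

theorem IsDCBU.cliqueFree_three {d : ℕ} {V : Type} {G : SimpleGraph V} (h : IsDCBU d G) :
    G.CliqueFree 3 := by
  classical
  obtain ⟨l, r, hlr, hG⟩ := h.exists_intervals
  intro s hs
  obtain ⟨a, b, c, hab, hac, hbc, -⟩ := SimpleGraph.is3Clique_iff.1 hs
  have := hlr a
  have := hlr b
  have := hlr c
  rcases hG _ _ hab with h1 | h1 <;> rcases hG _ _ hac with h2 | h2 <;>
    rcases hG _ _ hbc with h3 | h3 <;> linarith

theorem IsDCBU.of_embedding {d : ℕ} {V W : Type} {G : SimpleGraph V} {H : SimpleGraph W}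
    (h : IsDCBU d G) (f : H ↪g G) : IsDCBU d H := by
  obtain ⟨hd, B, hadj, ht⟩ := isDCBU_iff.1 h
  refine isDCBU_iff.2 ⟨hd, fun v => B (f v), fun u v huv => ?_, fun u v huv => ?_⟩
  · rw [← f.map_adj_iff]
    exact hadj _ _ (f.injective.ne huv)
  · exact ht _ _ (f.map_adj_iff.2 huv)

/-- Taking the product of every box with a unit cube raises the dimension. -/
theorem IsDCBU.mono {d e : ℕ} (hde : d ≤ e) {V : Type} {G : SimpleGraph V} (h : IsDCBU d G) :
    IsDCBU e G := by
  obtain ⟨hd, B, hadj, ht⟩ := isDCBU_iff.1 h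
  refine isDCBU_iff.2 ⟨hd.trans_le hde, fun v =>
    ⟨fun i => if hi : (i : ℕ) < d then (B v).lower ⟨i, hi⟩ else 0,
     fun i => if hi : (i : ℕ) < d then (B v).upper ⟨i, hi⟩ else 1, fun i => ?_⟩,
    fun u v huv => ?_, fun u v huv => ?_⟩
  · split_ifs with hi
    · exact (B v).lower_lt_upper _
    · exact one_pos
  · rw [hadj u v huv]
    constructor
    · intro h i
      by_cases hi : (i : ℕ) < d
      · simpa [hi] using h ⟨i, hi⟩
      · simp [hi]
    · intro h i
      have := h ⟨i, i.2.trans_le hde⟩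
      simpa using this
  · simpa [hd] using ht u v huv

theorem isGeometricClass_dCBUGraphs (d : ℕ) : IsGeometricClass (dCBUGraphs d) := by
  rintro G ⟨-, B, hB, -⟩
  exact ⟨d, _, hB⟩

theorem isHereditary_dCBUGraphs (d : ℕ) : IsHereditary (dCBUGraphs d) :=
  fun _ _ hG ⟨f⟩ => IsDCBU.of_embedding hG f

theorem isTriangleFreeClass_dCBUGraphs (d : ℕ) : IsTriangleFreeClass (dCBUGraphs d) :=
  fun _ hG => IsDCBU.cliqueFree_three hG

theorem dCBUGraphs_mono {d e : ℕ} (h : d ≤ e) : dCBUGraphs d ⊆ dCBUGraphs e :=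
  fun _ hG => IsDCBU.mono h hG

theorem IsDCBU.of_int {d : ℕ} (hd : 0 < d) {V : Type} {G : SimpleGraph V} (lo up : V → Fin d → ℤ)
    (hlt : ∀ v i, lo v i < up v i)
    (hadj : ∀ u v, u ≠ v → (G.Adj u v ↔ ∀ i, lo u i ≤ up v i ∧ lo v i ≤ up u i))
    (ht : ∀ u v, G.Adj u v → up u ⟨0, hd⟩ = lo v ⟨0, hd⟩ ∨ up v ⟨0, hd⟩ = lo u ⟨0, hd⟩) :
    IsDCBU d G := by
  refine isDCBU_iff.2 ⟨hd, fun v => ⟨fun i => lo v i, fun i => up v i, fun i => ?_⟩,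
    fun u v huv => ?_, fun u v huv => ?_⟩
  · exact_mod_cast hlt v i
  · simpa using hadj u v huv
  · simpa using ht u v huv

/-! ### Frames -/

namespace Frame

/-- The only way in which two frames of a Burling family meet: the right side of `F` crosses
the top and the bottom of `G`, whose left side lies in the interior of `F`. -/
def Crosses (F G : Frame) : Prop :=
  F.x₁ < G.x₁ ∧ G.x₁ < F.x₂ ∧ F.x₂ < G.x₂ ∧ F.y₁ < G.y₁ ∧ G.y₂ < F.y₂

/-- The frame `F` lies in the interior of `G`. -/
def Inside (F G : Frame) : Prop :=
  G.x₁ < F.x₁ ∧ F.x₂ < G.x₂ ∧ G.y₁ < F.y₁ ∧ F.y₂ < G.y₂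

/-- The regions bounded by `F` and `G` are disjoint. -/
def Apart (F G : Frame) : Prop :=
  F.x₂ < G.x₁ ∨ G.x₂ < F.x₁ ∨ F.y₂ < G.y₁ ∨ G.y₂ < F.y₁

theorem mem_left {F : Frame} {p : ℝ × ℝ} :
    p ∈ F.left ↔ p.1 = F.x₁ ∧ F.y₁ ≤ p.2 ∧ p.2 ≤ F.y₂ := by
  simp [left, Set.mem_prod]

theorem mem_right {F : Frame} {p : ℝ × ℝ} :
    p ∈ F.right ↔ p.1 = F.x₂ ∧ F.y₁ ≤ p.2 ∧ p.2 ≤ F.y₂ := by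
  simp [right, Set.mem_prod]

theorem mem_bottom {F : Frame} {p : ℝ × ℝ} :
    p ∈ F.bottom ↔ (F.x₁ ≤ p.1 ∧ p.1 ≤ F.x₂) ∧ p.2 = F.y₁ := by
  simp [bottom, Set.mem_prod]

theorem mem_top {F : Frame} {p : ℝ × ℝ} :
    p ∈ F.top ↔ (F.x₁ ≤ p.1 ∧ p.1 ≤ F.x₂) ∧ p.2 = F.y₂ := by
  simp [top, Set.mem_prod]

theorem mem_region {F : Frame} {p : ℝ × ℝ} :
    p ∈ F.region ↔ (F.x₁ ≤ p.1 ∧ p.1 ≤ F.x₂) ∧ F.y₁ ≤ p.2 ∧ p.2 ≤ F.y₂ := by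
  simp only [region, Set.mem_prod, Set.mem_Icc]

theorem mem_border {F : Frame} {p : ℝ × ℝ} :
    p ∈ F.border ↔ p ∈ F.region ∧ (p.1 = F.x₁ ∨ p.1 = F.x₂ ∨ p.2 = F.y₁ ∨ p.2 = F.y₂) := by
  have := F.hx
  have := F.hy
  simp only [border, Set.mem_union, mem_left, mem_right, mem_bottom, mem_top, mem_region]
  constructor
  · rintro (((⟨h, h1, h2⟩ | ⟨h, h1, h2⟩) | ⟨⟨h1, h2⟩, h⟩) | ⟨⟨h1, h2⟩, h⟩) <;>
      refine ⟨⟨⟨?_, ?_⟩, ?_, ?_⟩, ?_⟩ <;> first | linarith | simp [h]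
  · rintro ⟨⟨⟨h1, h2⟩, h3, h4⟩, h | h | h | h⟩ <;> simp [*]

variable {F G : Frame}

theorem left_subset_border : F.left ⊆ F.border := fun _ h => Or.inl (Or.inl (Or.inl h))

theorem right_subset_border : F.right ⊆ F.border := fun _ h => Or.inl (Or.inl (Or.inr h))

theorem bottom_subset_border : F.bottom ⊆ F.border := fun _ h => Or.inl (Or.inr h)

theorem top_subset_border : F.top ⊆ F.border := fun _ h => Or.inr h

theorem Crosses.right_inter_top (h : F.Crosses G) : (F.right ∩ G.top).Nonempty := by
  obtain ⟨h1, h2, h3, h4, h5⟩ := h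
  have := G.hy
  exact ⟨(F.x₂, G.y₂), mem_right.2 ⟨rfl, by dsimp only; linarith, h5.le⟩,
    mem_top.2 ⟨⟨h2.le, h3.le⟩, rfl⟩⟩

theorem Crosses.right_inter_bottom (h : F.Crosses G) : (F.right ∩ G.bottom).Nonempty := by
  obtain ⟨h1, h2, h3, h4, h5⟩ := h
  have := G.hy
  exact ⟨(F.x₂, G.y₁), mem_right.2 ⟨rfl, h4.le, by dsimp only; linarith⟩,
    mem_bottom.2 ⟨⟨h2.le, h3.le⟩, rfl⟩⟩

theorem Crosses.border_inter_border (h : F.Crosses G) : (F.border ∩ G.border).Nonempty :=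
  h.right_inter_top.mono (Set.inter_subset_inter right_subset_border top_subset_border)

theorem Crosses.disjoint_left_border (h : F.Crosses G) : Disjoint F.left G.border := by
  obtain ⟨h1, h2, h3, h4, h5⟩ := h
  rw [Set.disjoint_left]
  intro p hp hq
  rw [mem_left] at hp
  rw [mem_border, mem_region] at hq
  linarith [hq.1.1.1]

theorem Crosses.disjoint_crossed_left (h : F.Crosses G) : Disjoint G.left F.border := by
  obtain ⟨h1, h2, h3, h4, h5⟩ := h
  rw [Set.disjoint_left]
  intro p hp hq
  rw [mem_left] at hp
  rw [mem_border, mem_region] at hq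
  rcases hq.2 with h | h | h | h <;> linarith [hp.1, hp.2.1, hp.2.2]

theorem Crosses.disjoint_crossed_right (h : F.Crosses G) : Disjoint G.right F.border := by
  obtain ⟨h1, h2, h3, h4, h5⟩ := h
  rw [Set.disjoint_left]
  intro p hp hq
  rw [mem_right] at hp
  rw [mem_border, mem_region] at hq
  linarith [hq.1.1.2]

theorem Inside.disjoint (h : F.Inside G) : Disjoint F.border G.border := by
  obtain ⟨h1, h2, h3, h4⟩ := h
  rw [Set.disjoint_left]
  intro p hp hq
  rw [mem_border, mem_region] at hp hq
  rcases hq.2 with h | h | h | h <;> linarith [hp.1.1.1, hp.1.1.2, hp.1.2.1, hp.1.2.2]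

theorem Apart.disjoint (h : F.Apart G) : Disjoint F.border G.border := by
  rw [Set.disjoint_left]
  intro p hp hq
  rw [mem_border, mem_region] at hp hq
  obtain ⟨⟨⟨_, _⟩, _, _⟩, -⟩ := hp
  obtain ⟨⟨⟨_, _⟩, _, _⟩, -⟩ := hq
  rcases h with h | h | h | h <;> linarith

theorem border_subset_region_iff :
    F.border ⊆ G.region ↔ G.x₁ ≤ F.x₁ ∧ F.x₂ ≤ G.x₂ ∧ G.y₁ ≤ F.y₁ ∧ F.y₂ ≤ G.y₂ := by
  have hx := F.hx
  have hy := F.hy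
  constructor
  · intro h
    have h1 := mem_region.1 (h (left_subset_border (mem_left.2 ⟨rfl, le_rfl, hy.le⟩) :
      (F.x₁, F.y₁) ∈ F.border))
    have h2 := mem_region.1 (h (right_subset_border (mem_right.2 ⟨rfl, hy.le, le_rfl⟩) :
      (F.x₂, F.y₂) ∈ F.border))
    exact ⟨h1.1.1, h2.1.2, h1.2.1, h2.2.2⟩
  · rintro ⟨h1, h2, h3, h4⟩ p hp
    obtain ⟨⟨a, b⟩, c, d⟩ := mem_region.1 (mem_border.1 hp).1
    exact mem_region.2 ⟨⟨h1.trans a, b.trans h2⟩, h3.trans c, d.trans h4⟩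

theorem border_subset_inner_iff : F.border ⊆ G.inner ↔ F.Inside G := by
  have hx := F.hx
  have hy := F.hy
  constructor
  · intro h
    have h1 := h (left_subset_border (mem_left.2 ⟨rfl, le_rfl, hy.le⟩) : (F.x₁, F.y₁) ∈ F.border)
    have h2 := h (right_subset_border (mem_right.2 ⟨rfl, hy.le, le_rfl⟩) :
      (F.x₂, F.y₂) ∈ F.border)
    exact ⟨h1.1.1, h2.1.2, h1.2.1, h2.2.2⟩
  · rintro ⟨h1, h2, h3, h4⟩ p hp
    obtain ⟨⟨a, b⟩, c, d⟩ := mem_region.1 (mem_border.1 hp).1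
    exact ⟨⟨h1.trans_le a, b.trans_lt h2⟩, h3.trans_le c, d.trans_lt h4⟩

/-- Two frames with disjoint borders whose interiors have a point in common are nested. -/
theorem inside_or_inside_of_disjoint (h : Disjoint F.border G.border) {x y : ℝ}
    (hF : (F.x₁ < x ∧ x < F.x₂) ∧ F.y₁ < y ∧ y < F.y₂)
    (hG : (G.x₁ < x ∧ x < G.x₂) ∧ G.y₁ < y ∧ y < G.y₂) : F.Inside G ∨ G.Inside F := by
  have key : ∀ A B : Frame, Disjoint A.border B.border →
      ((A.x₁ < x ∧ x < A.x₂) ∧ A.y₁ < y ∧ y < A.y₂) →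
      ((B.x₁ < x ∧ x < B.x₂) ∧ B.y₁ < y ∧ y < B.y₂) → A.x₁ < B.x₁ → B.Inside A := by
    rintro A B h ⟨⟨a1, a2⟩, a3, a4⟩ ⟨⟨b1, b2⟩, b3, b4⟩ hlt
    rw [Set.disjoint_left] at h
    have hy₁ : A.y₁ < B.y₁ := by
      by_contra! hle
      exact h (bottom_subset_border (mem_bottom.2
          (by dsimp only; exact ⟨⟨hlt.le, (b1.trans a2).le⟩, rfl⟩)) : (B.x₁, A.y₁) ∈ A.border)
        (left_subset_border (mem_left.2 (by dsimp only; exact ⟨rfl, hle, (a3.trans b4).le⟩)))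
    have hy₂ : B.y₂ < A.y₂ := by
      by_contra! hle
      exact h (top_subset_border (mem_top.2
          (by dsimp only; exact ⟨⟨hlt.le, (b1.trans a2).le⟩, rfl⟩)) : (B.x₁, A.y₂) ∈ A.border)
        (left_subset_border (mem_left.2 (by dsimp only; exact ⟨rfl, (b3.trans a4).le, hle⟩)))
    have hx₂ : B.x₂ < A.x₂ := by
      by_contra! hle
      exact h (right_subset_border (mem_right.2
          (by dsimp only; exact ⟨rfl, hy₁.le, (b3.trans a4).le⟩)) : (A.x₂, B.y₁) ∈ A.border)
        (bottom_subset_border (mem_bottom.2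
          (by dsimp only; exact ⟨⟨(b1.trans a2).le, hle⟩, rfl⟩)))
    exact ⟨hlt, hx₂, hy₁, hy₂⟩
  rcases lt_trichotomy F.x₁ G.x₁ with hlt | heq | hlt
  · exact Or.inr (key F G h hF hG hlt)
  · exact absurd (left_subset_border
        (mem_left.2 (by dsimp only; exact ⟨heq, hG.2.1.le, hG.2.2.le⟩)))
      (Set.disjoint_left.1 h (left_subset_border
        (mem_left.2 ⟨rfl, hF.2.1.le, hF.2.2.le⟩) : (F.x₁, y) ∈ F.border))
  · exact Or.inl (key G F h.symm hG hF hlt)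

/-- If `F` and `G` cross the same frame and do not meet, then they are nested, since both contain
the left side of that frame. -/
theorem Crosses.inside_or_inside {H : Frame} (h : Disjoint F.border G.border)
    (hF : F.Crosses H) (hG : G.Crosses H) : F.Inside G ∨ G.Inside F := by
  have := H.hy
  obtain ⟨a1, a2, -, a3, a4⟩ := hF
  obtain ⟨b1, b2, -, b3, b4⟩ := hG
  exact inside_or_inside_of_disjoint h (x := H.x₁) (y := H.y₁)
    ⟨⟨a1, a2⟩, a3, by linarith⟩ ⟨⟨b1, b2⟩, b3, by linarith⟩

end Frame

open Frame

namespace IsBurlingFamily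

variable {V : Type} {F : V → Frame}

theorem crosses_of_right (hF : IsBurlingFamily F) {u v : V} (huv : u ≠ v)
    (h : ((F u).right ∩ (F v).border).Nonempty) : (F u).Crosses (F v) := by
  obtain ⟨⟨p, hp, hp'⟩, ⟨q, hq, hq'⟩⟩ := hF.right_side u v huv h
  rw [mem_right] at hp hq
  rw [mem_top] at hp'
  rw [mem_bottom] at hq'
  have hl := Set.disjoint_left.1 (hF.left_side u v huv)
  have hl' := Set.disjoint_left.1 (hF.left_side v u huv.symm)
  have := (F u).hx
  have := (F u).hy
  have := (F v).hx
  have := (F v).hy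
  have h1 : (F u).x₁ < (F v).x₁ := by
    by_contra! hle
    exact hl (mem_left.2 ⟨rfl, hq.2.1, hq.2.2⟩ : ((F u).x₁, q.2) ∈ _)
      (bottom_subset_border (mem_bottom.2
        (by dsimp only; exact ⟨⟨hle, by linarith⟩, hq'.2⟩)))
  have h2 : (F v).x₁ < (F u).x₂ := by
    by_contra! hle
    exact hl' (mem_left.2 (by dsimp only; exact ⟨by linarith, hq'.2.ge, by linarith⟩) :
      ((F u).x₂, q.2) ∈ _) (right_subset_border (mem_right.2 ⟨rfl, hq.2.1, hq.2.2⟩))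
  have h3 : (F u).y₁ < (F v).y₁ := by
    by_contra! hle
    exact hl' (mem_left.2 ⟨rfl, le_rfl, by linarith⟩ : ((F v).x₁, (F v).y₁) ∈ _)
      (bottom_subset_border (mem_bottom.2 (by dsimp only; exact ⟨⟨h1.le, h2.le⟩, by linarith⟩)))
  have h4 : (F v).y₂ < (F u).y₂ := by
    by_contra! hle
    exact hl' (mem_left.2 ⟨rfl, by linarith, le_rfl⟩ : ((F v).x₁, (F v).y₂) ∈ _)
      (top_subset_border (mem_top.2 (by dsimp only; exact ⟨⟨h1.le, h2.le⟩, by linarith⟩)))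
  refine ⟨h1, h2, ?_, h3, h4⟩
  by_contra! hle
  -- The right sides would touch, so that of `v` would have to reach the top of `u`.
  obtain ⟨⟨s, hs, hs'⟩, -⟩ := hF.right_side v u huv.symm
    ⟨((F v).x₂, (F v).y₁), mem_right.2 ⟨rfl, le_rfl, by linarith⟩,
      right_subset_border (mem_right.2
        (by dsimp only; exact ⟨by linarith, by linarith, by linarith⟩))⟩
  rw [mem_right] at hs
  rw [mem_top] at hs'
  linarith [hs.2.2, hs'.2]

theorem crosses_or_crosses (hF : IsBurlingFamily F) {u v : V} (huv : u ≠ v)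
    (h : ((F u).border ∩ (F v).border).Nonempty) :
    (F u).Crosses (F v) ∨ (F v).Crosses (F u) := by
  obtain ⟨p, hp, hq⟩ := h
  have hl := Set.disjoint_left.1 (hF.left_side u v huv)
  have hl' := Set.disjoint_left.1 (hF.left_side v u huv.symm)
  by_cases hu : p ∈ (F u).right
  · exact Or.inl (hF.crosses_of_right huv ⟨p, hu, hq⟩)
  by_cases hv : p ∈ (F v).right
  · exact Or.inr (hF.crosses_of_right huv.symm ⟨p, hv, hp⟩)
  -- Otherwise `p` lies on two overlapping horizontal sides, and the left end of the overlap
  -- belongs to a left side.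
  exfalso
  obtain ⟨hpr, hpb⟩ := mem_border.1 hp
  obtain ⟨hqr, hqb⟩ := mem_border.1 hq
  rw [mem_region] at hpr hqr
  have h1 : p.2 = (F u).y₁ ∨ p.2 = (F u).y₂ := by
    rcases hpb with h | h | h
    · exact absurd hq (hl (mem_left.2 ⟨h, hpr.2⟩))
    · exact absurd (mem_right.2 ⟨h, hpr.2⟩) hu
    · exact h
  have h2 : p.2 = (F v).y₁ ∨ p.2 = (F v).y₂ := by
    rcases hqb with h | h | h
    · exact absurd hp (hl' (mem_left.2 ⟨h, hqr.2⟩))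
    · exact absurd (mem_right.2 ⟨h, hqr.2⟩) hv
    · exact h
  rcases le_total (F u).x₁ (F v).x₁ with hle | hle
  · exact hl' (mem_left.2 ⟨rfl, hqr.2⟩ : ((F v).x₁, p.2) ∈ _)
      (mem_border.2 ⟨mem_region.2 ⟨⟨hle, hqr.1.1.trans hpr.1.2⟩, hpr.2⟩, Or.inr (Or.inr h1)⟩)
  · exact hl (mem_left.2 ⟨rfl, hpr.2⟩ : ((F u).x₁, p.2) ∈ _)
      (mem_border.2 ⟨mem_region.2 ⟨⟨hle, hpr.1.1.trans hqr.1.2⟩, hqr.2⟩, Or.inr (Or.inr h2)⟩)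

/-- The frames that leave a given frame through its right side are not nested. -/
theorem not_inside (hF : IsBurlingFamily F) {u v w : V} (huv : u ≠ v) (hwu : w ≠ u) (hwv : w ≠ v)
    (hu : (F w).Crosses (F u)) (hv : (F w).Crosses (F v)) : ¬ (F u).Inside (F v) := by
  intro h
  have hd := hF.nested u v w huv hwu hwv (border_subset_inner_iff.2 h)
    (Set.inter_comm _ _ ▸ hu.border_inter_border) (Set.inter_comm _ _ ▸ hv.border_inter_border)
  obtain ⟨p, hp, hp'⟩ := hu.right_inter_top
  exact Set.disjoint_left.1 hd (Or.inl (top_subset_border hp')) (Or.inr hp)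

/-- A family of frames any two of which cross, are disjoint or are nested is a Burling family as
soon as no frame lies in the overlap of two crossing ones and nested frames with a common neighbour
both cross it. -/
theorem of_crosses
    (h : ∀ u v, u ≠ v → (F u).Crosses (F v) ∨ (F v).Crosses (F u) ∨ (F u).Apart (F v) ∨
      (F u).Inside (F v) ∨ (F v).Inside (F u))
    (h₂ : ∀ u v w, (F u).Crosses (F v) →
      ¬ ((F v).x₁ ≤ (F w).x₁ ∧ (F w).x₂ ≤ (F u).x₂ ∧ (F v).y₁ ≤ (F w).y₁ ∧ (F w).y₂ ≤ (F v).y₂))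
    (h₃ : ∀ u v w, (F u).Inside (F v) →
      ((F u).Crosses (F w) ∨ (F w).Crosses (F u)) → ((F v).Crosses (F w) ∨ (F w).Crosses (F v)) →
      (F u).Crosses (F w) ∧ (F v).Crosses (F w)) : IsBurlingFamily F := by
  have hcr : ∀ u v, u ≠ v → ((F u).border ∩ (F v).border).Nonempty →
      (F u).Crosses (F v) ∨ (F v).Crosses (F u) := by
    intro u v huv hne
    rw [← Set.not_disjoint_iff_nonempty_inter] at hne
    rcases h u v huv with h | h | h | h | h
    · exact Or.inl h
    · exact Or.inr h
    · exact absurd h.disjoint hne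
    · exact absurd h.disjoint hne
    · exact absurd h.disjoint.symm hne
  constructor
  · intro u v huv
    by_contra hne
    rw [Set.not_disjoint_iff_nonempty_inter] at hne
    rcases hcr u v huv (hne.mono (Set.inter_subset_inter_left _ left_subset_border)) with h | h
    · exact Set.not_disjoint_iff_nonempty_inter.2 hne h.disjoint_left_border
    · exact Set.not_disjoint_iff_nonempty_inter.2 hne h.disjoint_crossed_left
  · intro u v huv hne
    rcases hcr u v huv (hne.mono (Set.inter_subset_inter_left _ right_subset_border)) with h | h
    · exact ⟨h.right_inter_top, h.right_inter_bottom⟩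
    · exact absurd h.disjoint_crossed_right (Set.not_disjoint_iff_nonempty_inter.2 hne)
  · intro u v w huv hwu hwv hne hsub
    rw [Set.subset_inter_iff, border_subset_region_iff, border_subset_region_iff] at hsub
    obtain ⟨⟨a1, a2, a3, a4⟩, b1, b2, b3, b4⟩ := hsub
    rcases hcr u v huv hne with h | h
    · exact h₂ u v w h ⟨b1, a2, b3, b4⟩
    · exact h₂ v u w h ⟨a1, b2, a3, a4⟩
  · intro u v w huv hwu hwv hin hu hv
    obtain ⟨hu, hv⟩ := h₃ u v w (border_subset_inner_iff.1 hin) (hcr u w hwu.symm hu)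
      (hcr v w hwv.symm hv)
    rw [Set.disjoint_union_left, Set.disjoint_union_right, Set.disjoint_union_right]
    exact ⟨⟨hu.disjoint_crossed_left.symm, hu.disjoint_crossed_right.symm⟩,
      ⟨hv.disjoint_crossed_left.symm, hv.disjoint_crossed_right.symm⟩⟩

theorem injective_border (hF : IsBurlingFamily F) :
    Function.Injective fun v => (F v).border := by
  intro u v huv
  by_contra hne
  have h : (F u).border = (F v).border := huv
  have hm : ((F u).x₁, (F u).y₁) ∈ (F u).left := mem_left.2 ⟨rfl, le_rfl, (F u).hy.le⟩
  exact Set.disjoint_left.1 (hF.left_side u v hne) hm (h ▸ left_subset_border hm)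

end IsBurlingFamily

/-! ### A wheel that is a 2-CBU graph but not a Burling graph -/

/-- The graph of the three-dimensional cube without one vertex: the hub `6` is adjacent to every
other vertex of the hexagon `0, 1, 2, 3, 4, 5`. -/
def cubeMinusVertex : SimpleGraph (Fin 7) :=
  SimpleGraph.fromRel fun u v =>
    (u, v) ∈ [(0, 1), (1, 2), (2, 3), (3, 4), (4, 5), (5, 0), (6, 0), (6, 2), (6, 4)]

instance : DecidableRel cubeMinusVertex.Adj :=
  fun u v => decidable_of_iff _ (SimpleGraph.fromRel_adj _ u v).symm

theorem isWheel_cubeMinusVertex : IsWheel cubeMinusVertex := by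
  refine ⟨6, 6, by norm_num, ⟨SimpleGraph.Iso.symm ⟨finSuccAboveEquiv 6, ?_⟩⟩, ?_⟩
  · intro a b
    change cubeMinusVertex.Adj (Fin.succAbove 6 a) (Fin.succAbove 6 b) ↔ _
    revert a b
    decide
  · rw [← SimpleGraph.coe_neighborFinset, Set.ncard_coe_finset]
    decide

theorem isDCBU_cubeMinusVertex : IsDCBU 2 cubeMinusVertex :=
  IsDCBU.of_int two_pos
    ![![2, 7], ![3, 0], ![2, 0], ![1, 0], ![0, 0], ![1, 10], ![1, 4]]
    ![![3, 12], ![4, 12], ![3, 5], ![2, 2], ![1, 12], ![2, 12], ![2, 8]]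
    (by decide) (by decide) (by decide)

section BurlingRepresentation

variable {V : Type} {G : SimpleGraph V} {F : V → Frame}

theorem Frame.Crosses.ne {u v : V} (h : (F u).Crosses (F v)) : u ≠ v := by
  rintro rfl
  exact h.1.false

theorem IsIntersectionGraphOf.adj_of_crosses
    (hG : IsIntersectionGraphOf G fun v => (F v).border) {u v : V}
    (h : (F u).Crosses (F v)) : G.Adj u v :=
  (hG.2 u v).2 ⟨h.ne, h.border_inter_border⟩

theorem IsIntersectionGraphOf.disjoint_border
    (hG : IsIntersectionGraphOf G fun v => (F v).border) {u v : V} (huv : u ≠ v)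
    (h : ¬ G.Adj u v) : Disjoint (F u).border (F v).border := by
  by_contra hne
  exact h ((hG.2 u v).2 ⟨huv, Set.not_disjoint_iff_nonempty_inter.1 hne⟩)

theorem IsBurlingFamily.crosses_of_adj (hF : IsBurlingFamily F)
    (hG : IsIntersectionGraphOf G fun v => (F v).border) {u v : V} (h : G.Adj u v) :
    (F u).Crosses (F v) ∨ (F v).Crosses (F u) :=
  hF.crosses_or_crosses h.ne ((hG.2 u v).1 h).2

/-- A square has no directed path of length two: two frames between the same pair of opposite
corners would be both nested and not nested. -/
theorem IsBurlingFamily.not_crosses_of_square (hF : IsBurlingFamily F)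
    (hG : IsIntersectionGraphOf G fun v => (F v).border) {s p t q : V} (hst : s ≠ t) (hpq : p ≠ q)
    (hst' : ¬ G.Adj s t) (hpq' : ¬ G.Adj p q) (htq : G.Adj t q) (hqs : G.Adj q s)
    (hsp : (F s).Crosses (F p)) : ¬ (F p).Crosses (F t) := by
  intro hpt
  have hdst := hG.disjoint_border hst hst'
  have hdpq := hG.disjoint_border hpq hpq'
  have a1 := hsp.1
  have a3 := hsp.2.2.1
  have b1 := hpt.1
  have b3 := hpt.2.2.1
  rcases hF.crosses_of_adj hG hqs with hq | hq <;>
    rcases hF.crosses_of_adj hG htq with ht | ht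
  · linarith [hq.1, ht.1]
  · rcases Crosses.inside_or_inside hdpq hpt ht with h | h
    · linarith [h.2.1, hq.2.2.1]
    · linarith [h.1, hq.1]
  · rcases Crosses.inside_or_inside hdst hq ht with h | h
    · linarith [h.1]
    · linarith [h.2.1]
  · rcases Crosses.inside_or_inside hdpq hpt ht with h | h
    · exact hF.not_inside hpq hsp.ne hq.ne hsp hq h
    · exact hF.not_inside hpq.symm hq.ne hsp.ne hq hsp h

/-- In a square two opposite corners cross the other two. -/
theorem IsBurlingFamily.crosses_of_square (hF : IsBurlingFamily F)
    (hG : IsIntersectionGraphOf G fun v => (F v).border) {s p t q : V} (hst : s ≠ t) (hpq : p ≠ q)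
    (hst' : ¬ G.Adj s t) (hpq' : ¬ G.Adj p q) (hpt : G.Adj p t) (htq : G.Adj t q)
    (hqs : G.Adj q s) (hsp : (F s).Crosses (F p)) :
    (F t).Crosses (F p) ∧ (F t).Crosses (F q) ∧ (F s).Crosses (F q) := by
  have hadj := hG.adj_of_crosses hsp
  have hqp' : ¬ G.Adj q p := fun h => hpq' h.symm
  have hts' : ¬ G.Adj t s := fun h => hst' h.symm
  have htp : (F t).Crosses (F p) := (hF.crosses_of_adj hG hpt).resolve_left
    (hF.not_crosses_of_square hG hst hpq hst' hpq' htq hqs hsp)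
  refine ⟨htp, (hF.crosses_of_adj hG htq).resolve_right fun h => ?_,
    (hF.crosses_of_adj hG hqs).resolve_left fun h => ?_⟩
  · exact hF.not_crosses_of_square hG hpq.symm hst.symm hqp' hts' hadj.symm hqs.symm h htp
  · exact hF.not_crosses_of_square hG hpq.symm hst hqp' hst' hpt htq h hsp

theorem Frame.Crosses.of_inside {A B C D : Frame} (hAB : A.Inside B) (hBC : B.Inside C)
    (hA : A.Crosses D) (hC : C.Crosses D) : B.Crosses D := by
  obtain ⟨a1, a2, a3, a4⟩ := hAB
  obtain ⟨b1, b2, b3, b4⟩ := hBC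
  obtain ⟨c1, c2, c3, c4, c5⟩ := hA
  obtain ⟨d1, d2, d3, d4, d5⟩ := hC
  refine ⟨?_, ?_, ?_, ?_, ?_⟩ <;> linarith

/-- In an induced hexagon the orientation does not alternate: of the three sources, which would
form a chain under nesting, the middle one would cross the common neighbour of the other two. -/
theorem IsIntersectionGraphOf.not_alternating_hexagon
    (hG : IsIntersectionGraphOf G fun v => (F v).border) {a b c u w x : V}
    (hab : a ≠ b) (hbc : b ≠ c) (hca : c ≠ a)
    (hab' : ¬ G.Adj a b) (hbc' : ¬ G.Adj b c) (hca' : ¬ G.Adj c a)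
    (hcu : ¬ G.Adj c u) (haw : ¬ G.Adj a w) (hbx : ¬ G.Adj b x)
    (au : (F a).Crosses (F u)) (bu : (F b).Crosses (F u)) (bw : (F b).Crosses (F w))
    (cw : (F c).Crosses (F w)) (cx : (F c).Crosses (F x)) (ax : (F a).Crosses (F x)) : False := by
  have hu : ¬ (F c).Crosses (F u) := fun h => hcu (hG.adj_of_crosses h)
  have hw : ¬ (F a).Crosses (F w) := fun h => haw (hG.adj_of_crosses h)
  have hx : ¬ (F b).Crosses (F x) := fun h => hbx (hG.adj_of_crosses h)
  rcases Crosses.inside_or_inside (hG.disjoint_border hab hab') au bu with h1 | h1 <;>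
  rcases Crosses.inside_or_inside (hG.disjoint_border hbc hbc') bw cw with h2 | h2 <;>
  rcases Crosses.inside_or_inside (hG.disjoint_border hca hca') cx ax with h3 | h3
  · linarith [h1.1, h2.1, h3.1]
  · exact hx (.of_inside h1 h2 ax cx)
  · exact hw (.of_inside h3 h1 cw bw)
  · exact hu (.of_inside h3 h2 au bu)
  · exact hu (.of_inside h2 h3 bu au)
  · exact hw (.of_inside h1 h3 bw cw)
  · exact hx (.of_inside h2 h1 cx ax)
  · linarith [h1.1, h2.1, h3.1]

end BurlingRepresentation

theorem not_isBurling_cubeMinusVertex : ¬ IsBurling cubeMinusVertex := by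
  rintro ⟨-, F, hG, hF⟩
  rcases hF.crosses_of_adj hG (by decide : cubeMinusVertex.Adj 6 0) with h | h
  · obtain ⟨h10, h12, h62⟩ := hF.crosses_of_square hG (s := 6) (p := 0) (t := 1) (q := 2)
      (by decide) (by decide) (by decide) (by decide) (by decide) (by decide) (by decide) h
    obtain ⟨h32, h34, h64⟩ := hF.crosses_of_square hG (s := 6) (p := 2) (t := 3) (q := 4)
      (by decide) (by decide) (by decide) (by decide) (by decide) (by decide) (by decide) h62
    obtain ⟨h54, h50, -⟩ := hF.crosses_of_square hG (s := 6) (p := 4) (t := 5) (q := 0)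
      (by decide) (by decide) (by decide) (by decide) (by decide) (by decide) (by decide) h64
    exact hG.not_alternating_hexagon (by decide) (by decide) (by decide) (by decide)
      (by decide) (by decide) (by decide) (by decide) (by decide) h12 h32 h34 h54 h50 h10
  · obtain ⟨h26, h21, h01⟩ := hF.crosses_of_square hG (s := 0) (p := 6) (t := 2) (q := 1)
      (by decide) (by decide) (by decide) (by decide) (by decide) (by decide) (by decide) h
    obtain ⟨h46, h43, h23⟩ := hF.crosses_of_square hG (s := 2) (p := 6) (t := 4) (q := 3)
      (by decide) (by decide) (by decide) (by decide) (by decide) (by decide) (by decide) h26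
    obtain ⟨-, h05, h45⟩ := hF.crosses_of_square hG (s := 4) (p := 6) (t := 0) (q := 5)
      (by decide) (by decide) (by decide) (by decide) (by decide) (by decide) (by decide) h46
    exact hG.not_alternating_hexagon (by decide) (by decide) (by decide) (by decide)
      (by decide) (by decide) (by decide) (by decide) (by decide) h01 h21 h23 h43 h45 h05

/-! ### A Burling graph that is not a CBU graph -/

/-- The pairs `(u, v)` listed are those for which the right side of `burlingFrame u` crosses
`burlingFrame v`. -/
def burlingGraphNotCBU : SimpleGraph (Fin 8) :=
  SimpleGraph.fromRel fun u v =>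
    (u, v) ∈ [(2, 3), (3, 4), (1, 4), (2, 5), (1, 5), (0, 5), (3, 6), (1, 6), (0, 6), (4, 7),
      (0, 7)]

instance : DecidableRel burlingGraphNotCBU.Adj :=
  fun u v => decidable_of_iff _ (SimpleGraph.fromRel_adj _ u v).symm

/-- The corners `x₁, x₂, y₁, y₂` of the frames that represent `burlingGraphNotCBU`. -/
def burlingCorner : Fin 4 → Fin 8 → ℕ :=
  ![![0, 1, 2, 3, 6, 3, 6, 15], ![20, 14, 4, 8, 16, 22, 23, 24],
    ![0, 1, 2, 6, 9, 3, 7, 10], ![20, 15, 14, 13, 12, 4, 8, 11]]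

/-- The frames that represent `burlingGraphNotCBU`. -/
def burlingFrame (v : Fin 8) : Frame where
  x₁ := burlingCorner 0 v
  x₂ := burlingCorner 1 v
  y₁ := burlingCorner 2 v
  y₂ := burlingCorner 3 v
  hx := by exact_mod_cast (by decide : ∀ v, burlingCorner 0 v < burlingCorner 1 v) v
  hy := by exact_mod_cast (by decide : ∀ v, burlingCorner 2 v < burlingCorner 3 v) v

instance : DecidableRel fun u v => (burlingFrame u).Crosses (burlingFrame v) := fun u v =>
  decidable_of_iff (burlingCorner 0 u < burlingCorner 0 v ∧ burlingCorner 0 v < burlingCorner 1 u ∧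
      burlingCorner 1 u < burlingCorner 1 v ∧ burlingCorner 2 u < burlingCorner 2 v ∧
      burlingCorner 3 v < burlingCorner 3 u) (by simp [Crosses, burlingFrame])

instance : DecidableRel fun u v => (burlingFrame u).Inside (burlingFrame v) := fun u v =>
  decidable_of_iff (burlingCorner 0 v < burlingCorner 0 u ∧ burlingCorner 1 u < burlingCorner 1 v ∧
      burlingCorner 2 v < burlingCorner 2 u ∧ burlingCorner 3 u < burlingCorner 3 v)
    (by simp [Inside, burlingFrame])

instance : DecidableRel fun u v => (burlingFrame u).Apart (burlingFrame v) := fun u v =>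
  decidable_of_iff (burlingCorner 1 u < burlingCorner 0 v ∨ burlingCorner 1 v < burlingCorner 0 u ∨
      burlingCorner 3 u < burlingCorner 2 v ∨ burlingCorner 3 v < burlingCorner 2 u)
    (by simp [Apart, burlingFrame])

theorem burlingFrame_cases : ∀ u v, u ≠ v →
    (burlingFrame u).Crosses (burlingFrame v) ∨ (burlingFrame v).Crosses (burlingFrame u) ∨
    (burlingFrame u).Apart (burlingFrame v) ∨
    (burlingFrame u).Inside (burlingFrame v) ∨ (burlingFrame v).Inside (burlingFrame u) := by
  decide

theorem isBurlingFamily_burlingFrame : IsBurlingFamily burlingFrame := by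
  refine .of_crosses burlingFrame_cases (fun u v w => ?_) (by decide)
  have : ∀ u v w, (burlingFrame u).Crosses (burlingFrame v) →
      ¬ (burlingCorner 0 v ≤ burlingCorner 0 w ∧ burlingCorner 1 w ≤ burlingCorner 1 u ∧
        burlingCorner 2 v ≤ burlingCorner 2 w ∧ burlingCorner 3 w ≤ burlingCorner 3 v) := by
    decide
  simpa [burlingFrame] using this u v w

theorem isBurling_burlingGraphNotCBU : IsBurling burlingGraphNotCBU := by
  refine ⟨?_, burlingFrame, ⟨isBurlingFamily_burlingFrame.injective_border, fun u v => ?_⟩,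
    isBurlingFamily_burlingFrame⟩
  · intro s hs
    obtain ⟨a, b, c, hab, hac, hbc, -⟩ := SimpleGraph.is3Clique_iff.1 hs
    exact (by decide : ∀ a b c, burlingGraphNotCBU.Adj a b → burlingGraphNotCBU.Adj a c →
      ¬ burlingGraphNotCBU.Adj b c) a b c hab hac hbc
  · have key : ∀ u v, burlingGraphNotCBU.Adj u v ↔
        (burlingFrame u).Crosses (burlingFrame v) ∨ (burlingFrame v).Crosses (burlingFrame u) := by
      decide
    rw [key]
    constructor
    · rintro (h | h)
      · exact ⟨h.ne, h.border_inter_border⟩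
      · exact ⟨h.ne.symm, Set.inter_comm _ _ ▸ h.border_inter_border⟩
    · exact fun h => isBurlingFamily_burlingFrame.crosses_or_crosses h.1 h.2

/-- The squares `0 5 1 6` and `1 4 3 6` leave few patterns of contacts, and each of these forces a
cyclic inequality between interval ends along the remaining edges. -/
theorem not_isDCBU_burlingGraphNotCBU (d : ℕ) : ¬ IsDCBU d burlingGraphNotCBU := by
  intro h
  obtain ⟨l, r, hlr, hG⟩ := h.exists_intervals
  have h0 := hlr 0
  have h1 := hlr 1
  have h2 := hlr 2
  have h3 := hlr 3
  have h4 := hlr 4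
  have h5 := hlr 5
  have h6 := hlr 6
  have h7 := hlr 7
  rcases hG 0 5 (by decide) with a1 | a1 <;> rcases hG 1 5 (by decide) with a2 | a2 <;>
  rcases hG 0 6 (by decide) with a3 | a3 <;> rcases hG 1 6 (by decide) with a4 | a4 <;>
  try linarith
  all_goals
    rcases hG 1 4 (by decide) with a5 | a5 <;> rcases hG 3 4 (by decide) with a6 | a6 <;>
    rcases hG 3 6 (by decide) with a7 | a7 <;> try linarith
  all_goals
    rcases hG 2 5 (by decide) with a8 | a8 <;> rcases hG 2 3 (by decide) with a9 | a9 <;>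
    try linarith
  all_goals
    rcases hG 4 7 (by decide) with b1 | b1 <;> rcases hG 0 7 (by decide) with b2 | b2 <;> linarith

/-! ### Separating the dimensions -/

/-- The complete bipartite graph on two copies of `Option ι` without the edges that join the two
copies of an element of `ι`; thus `none` is adjacent to the whole other side. -/
def crownWithApexes (ι : Type) : SimpleGraph (Bool × Option ι) where
  Adj p q := p.1 ≠ q.1 ∧ (p.2 = q.2 → p.2 = none)
  symm := ⟨fun _ _ h => ⟨h.1.symm, fun he => he ▸ h.2 he.symm⟩⟩
  loopless := ⟨fun _ h => h.1 rfl⟩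

/-- Each of the `d` coordinates separates at most one non-adjacent pair `aᵢ, bᵢ` in either
direction, and the first coordinate separates at most one such pair in all. -/
theorem card_lt_of_isDCBU_crownWithApexes {d : ℕ} {ι : Type} [Fintype ι]
    (h : IsDCBU d (crownWithApexes ι)) : Fintype.card ι < d * 2 := by
  classical
  obtain ⟨hd, B, hadj, ht⟩ := isDCBU_iff.1 h
  set a : Option ι → BoxIntegral.Box (Fin d) := fun i => B (false, i) with ha
  set b : Option ι → BoxIntegral.Box (Fin d) := fun i => B (true, i) with hb
  have meet : ∀ i j, (i = j → i = none) → ∀ k,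
      (a i).lower k ≤ (b j).upper k ∧ (b j).lower k ≤ (a i).upper k := fun i j hij =>
    (hadj (false, i) (true, j) (by simp)).1 ⟨by simp, hij⟩
  have touch : ∀ i j, (i = j → i = none) → (a i).upper ⟨0, hd⟩ = (b j).lower ⟨0, hd⟩ ∨
      (b j).upper ⟨0, hd⟩ = (a i).lower ⟨0, hd⟩ := fun i j hij =>
    ht (false, i) (true, j) ⟨by simp, hij⟩
  have sep : ∀ i : ι, ∃ p : Fin d × Bool,
      if p.2 then (b (some i)).upper p.1 < (a (some i)).lower p.1
      else (a (some i)).upper p.1 < (b (some i)).lower p.1 := by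
    intro i
    by_contra! hc
    have hij : (crownWithApexes ι).Adj (false, some i) (true, some i) :=
      (hadj _ _ (by simp)).2 fun k => ⟨by simpa using hc (k, true), by simpa using hc (k, false)⟩
    simpa using hij.2 rfl
  choose f hf using sep
  have hinj : Function.Injective f := by
    intro i j hij
    by_contra hne
    have hi := hf i
    have hj := hf j
    have h1 := meet (some i) (some j) (by simp [hne]) (f i).1
    have h2 := meet (some j) (some i) (by simp [Ne.symm hne]) (f i).1
    rw [← hij] at hj
    split_ifs at hi hj <;> linarith
  have hsurj : ¬ Function.Surjective f := by
    intro hs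
    obtain ⟨i, hi⟩ := hs (⟨0, hd⟩, true)
    obtain ⟨j, hj⟩ := hs (⟨0, hd⟩, false)
    have hne : i ≠ j := by
      rintro rfl
      simp [hi] at hj
    have h1 := hf i
    have h2 := hf j
    simp only [hi, hj, if_true, Bool.false_eq_true, if_false] at h1 h2
    -- In the first coordinate `aᵢ` lies after `bᵢ` and `aⱼ` before `bⱼ`. Each choice of the end at
    -- which two adjacent intervals touch is then inconsistent; for instance `a` at `none` would
    -- have to fill the gap between `bᵢ` and `bⱼ`, which `b` at `none` overlaps.
    have l1 := (a (some i)).lower_lt_upper ⟨0, hd⟩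
    have l2 := (a (some j)).lower_lt_upper ⟨0, hd⟩
    have l3 := (b (some i)).lower_lt_upper ⟨0, hd⟩
    have l4 := (b (some j)).lower_lt_upper ⟨0, hd⟩
    have l5 := (a none).lower_lt_upper ⟨0, hd⟩
    have l6 := (b none).lower_lt_upper ⟨0, hd⟩
    rcases touch (some i) (some j) (by simp [hne]) with c1 | c1 <;>
    rcases touch (some j) (some i) (by simp [Ne.symm hne]) with c2 | c2 <;>
    rcases touch (some i) none (by simp) with c3 | c3 <;>
    rcases touch (some j) none (by simp) with c4 | c4 <;>
    try linarith
    all_goals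
      rcases touch none (some i) (by simp) with c5 | c5 <;>
      rcases touch none (some j) (by simp) with c6 | c6 <;>
      try linarith
    all_goals rcases touch none none (by simp) with c7 | c7 <;> linarith
  simpa using Fintype.card_lt_of_injective_not_surjective f hinj hsurj

namespace crownWithApexes

variable {d : ℕ}

/-- Lower corners of the boxes of the first side. The coordinate `0` serves to make the boxes of
the second side disjoint, and `aᵢ` for `i = (j, s)` is the outermost box of its side in
coordinate `j`. -/
def aLower : Option (Fin d × Bool) → ℕ → ℤ
  | none, _ => 0
  | some (j, s), k =>
    if k = 0 then (if (j : ℕ) = 0 then cond s 0 2 else 0)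
    else if k = j then cond s 6 (-7)
    else if (j : ℕ) = 0 ∧ k = 1 then cond s 3 (-4) else 0

/-- Upper corners of the boxes of the first side. -/
def aUpper : Option (Fin d × Bool) → ℕ → ℤ
  | none, k => if k = 0 then 8 * d + 1 else 1
  | some (j, s), k =>
    if k = 0 then (if (j : ℕ) = 0 then cond s (8 * d - 1) (8 * d + 1) else 8 * d + 1)
    else if k = j then cond s 7 (-6)
    else if (j : ℕ) = 0 ∧ k = 1 then cond s 4 (-3) else 1

/-- The boxes of the second side are flat slabs at different heights. -/
def height : Option (Fin d × Bool) → ℤ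
  | none => 4
  | some (j, s) => if (j : ℕ) = 0 then cond s (8 * d) 0 else 8 * j + cond s 4 0

/-- Lower corners of the boxes of the second side. -/
def bLower : Option (Fin d × Bool) → ℕ → ℤ
  | none, k => if k = 0 then height (d := d) none else -8
  | some (j, s), k => if k = 0 then height (some (j, s)) else if k = j then cond s (-8) (-4) else -8

/-- Upper corners of the boxes of the second side. -/
def bUpper : Option (Fin d × Bool) → ℕ → ℤ
  | none, k => if k = 0 then height (d := d) none + 1 else 8
  | some (j, s), k => if k = 0 then height (some (j, s)) + 1 else if k = j then cond s 4 8 else 8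

theorem aLower_lt_aUpper (i : Option (Fin d × Bool)) (hd : 2 ≤ d) (k : ℕ) :
    aLower i k < aUpper i k := by
  rcases i with _ | ⟨j, _ | _⟩ <;> simp only [aLower, aUpper, cond_true, cond_false] <;>
    split_ifs <;> omega

theorem bLower_lt_bUpper (i : Option (Fin d × Bool)) (k : ℕ) : bLower i k < bUpper i k := by
  rcases i with _ | ⟨j, _ | _⟩ <;> simp only [bLower, bUpper, cond_true, cond_false] <;>
    split_ifs <;> omega

theorem exists_aUpper_lt_aLower {i i' : Option (Fin d × Bool)} (hd : 2 ≤ d) (h : i ≠ i') :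
    ∃ k : Fin d, aUpper i k < aLower i' k ∨ aUpper i' k < aLower i k := by
  -- The coordinate `1` separates the boxes that are not outermost in a coordinate other than `0`.
  rcases i with _ | ⟨j, s⟩ <;> rcases i' with _ | ⟨j', s'⟩
  · exact absurd rfl h
  · by_cases hj : (j' : ℕ) = 0
    · exact ⟨⟨1, hd⟩, by cases s' <;> simp [aUpper, aLower, hj]⟩
    · exact ⟨j', by cases s' <;> simp [aUpper, aLower, hj]⟩
  · by_cases hj : (j : ℕ) = 0
    · exact ⟨⟨1, hd⟩, by cases s <;> simp [aUpper, aLower, hj]⟩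
    · exact ⟨j, by cases s <;> simp [aUpper, aLower, hj]⟩
  · have hne : (j : ℕ) = j' → s ≠ s' := by
      rintro hj rfl
      exact h (by rw [Fin.ext hj])
    by_cases hj : (j : ℕ) = 0
    · by_cases hj' : (j' : ℕ) = 0
      · exact ⟨⟨1, hd⟩, by cases s <;> cases s' <;> simp_all [aUpper, aLower]⟩
      · refine ⟨j', ?_⟩
        have hjj : (j' : ℕ) ≠ j := by omega
        cases s <;> cases s' <;> simp only [aUpper, aLower, cond_true, cond_false] <;>
          split_ifs <;> omega
    · refine ⟨j, ?_⟩
      cases s <;> cases s' <;> simp only [aUpper, aLower, cond_true, cond_false] <;>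
          split_ifs <;> simp_all

theorem exists_bUpper_lt_bLower {i i' : Option (Fin d × Bool)} (hd : 2 ≤ d) (h : i ≠ i') :
    ∃ k : Fin d, bUpper i k < bLower i' k ∨ bUpper i' k < bLower i k := by
  refine ⟨⟨0, by omega⟩, ?_⟩
  have key : height i + 1 < height i' ∨ height i' + 1 < height i := by
    rcases i with _ | ⟨j, s⟩ <;> rcases i' with _ | ⟨j', s'⟩
    · exact absurd rfl h
    · cases s' <;> simp only [height, cond_true, cond_false] <;> split_ifs <;> omega
    · cases s <;> simp only [height, cond_true, cond_false] <;> split_ifs <;> omega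
    · have hne : (j : ℕ) = j' → s ≠ s' := by
        rintro hj rfl
        exact h (by rw [Fin.ext hj])
      have := j.2
      have := j'.2
      cases s <;> cases s' <;> simp only [height, cond_true, cond_false] <;> split_ifs <;>
        simp at hne <;> omega
  rcases i with _ | ⟨j, s⟩ <;> rcases i' with _ | ⟨j', s'⟩ <;> exact key

theorem meet_iff (i i' : Option (Fin d × Bool)) (hd : 2 ≤ d) :
    (i = i' → i = none) ↔
      ∀ k : Fin d, aLower i k ≤ bUpper i' k ∧ bLower i' k ≤ aUpper i k := by
  rcases i with _ | ⟨j, s⟩ <;> rcases i' with _ | ⟨j', s'⟩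
  · simp only [implies_true, true_iff]
    intro k
    simp only [aLower, aUpper, bLower, bUpper, height]
    split_ifs <;> omega
  · simp only [implies_true, true_iff]
    intro k
    have := j'.2
    cases s' <;> simp only [aLower, aUpper, bLower, bUpper, height, cond_true, cond_false] <;>
      split_ifs <;> omega
  · simp only [reduceCtorEq, false_imp_iff, true_iff]
    intro k
    cases s <;> simp only [aLower, aUpper, bLower, bUpper, height, cond_true, cond_false] <;>
      split_ifs <;> omega
  · simp only [reduceCtorEq, imp_false, Option.some.injEq, Prod.mk.injEq]
    constructor
    · intro h k
      have hne : (j : ℕ) = j' → s ≠ s' := fun hj hs => h ⟨Fin.ext hj, hs⟩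
      have := j'.2
      have := j.2
      cases s <;> cases s' <;>
        simp only [aLower, aUpper, bLower, bUpper, height, cond_true, cond_false] <;>
        simp at hne <;> split_ifs <;> omega
    · rintro h ⟨rfl, rfl⟩
      have := h j
      revert this
      cases s <;> simp only [aLower, aUpper, bLower, bUpper, height, cond_true, cond_false] <;>
        split_ifs <;> omega

/-- The first side occupies `[0, 1]` and the second side `[1, 2]` in the first coordinate; the
other `d` coordinates separate the `2 * d` non-adjacent pairs. -/
theorem isDCBU (hd : 2 ≤ d) : IsDCBU (d + 1) (crownWithApexes (Fin d × Bool)) := by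
  refine IsDCBU.of_int d.succ_pos
    (fun v => Fin.cons (cond v.1 1 0) fun k => cond v.1 (bLower v.2 k) (aLower v.2 k))
    (fun v => Fin.cons (cond v.1 2 1) fun k => cond v.1 (bUpper v.2 k) (aUpper v.2 k)) ?_ ?_ ?_
  · rintro ⟨_ | _, i⟩ k <;> induction k using Fin.cases <;>
      simp [aLower_lt_aUpper i hd, bLower_lt_bUpper i]
  · rintro ⟨_ | _, i⟩ ⟨_ | _, i'⟩ hne <;>
      simp only [crownWithApexes, Fin.forall_fin_succ, Fin.cons_zero, Fin.cons_succ, cond_true,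
        cond_false]
    · obtain ⟨k, hk⟩ := exists_aUpper_lt_aLower hd (i := i) (i' := i') (by simpa using hne)
      simp only [ne_eq, not_true_eq_false, false_and, false_iff, not_and, not_forall]
      exact fun _ => ⟨k, by omega⟩
    · simp [meet_iff i i' hd]
    · have hcomm : (i = i' → i = none) ↔ (i' = i → i' = none) :=
        ⟨fun h e => e.trans (h e.symm), fun h e => e.trans (h e.symm)⟩
      simp [hcomm, meet_iff i' i hd, and_comm]
    · obtain ⟨k, hk⟩ := exists_bUpper_lt_bLower hd (i := i) (i' := i') (by simpa using hne)
      simp only [ne_eq, not_true_eq_false, false_and, false_iff, not_and, not_forall]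
      exact fun _ => ⟨k, by omega⟩
  · rintro ⟨_ | _, i⟩ ⟨_ | _, i'⟩ h
    · exact absurd rfl h.1
    · exact Or.inl rfl
    · exact Or.inr rfl
    · exact absurd rfl h.1

end crownWithApexes

theorem dCBUGraphs_ne_of_lt {d e : ℕ} (hd : 2 ≤ d) (hde : d < e) :
    dCBUGraphs d ≠ dCBUGraphs e := by
  intro h
  let G : FiniteGraph := ⟨_, inferInstance, crownWithApexes (Fin d × Bool)⟩
  have hG : G ∈ dCBUGraphs e := dCBUGraphs_mono hde (crownWithApexes.isDCBU hd)
  rw [← h] at hG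
  simpa using card_lt_of_isDCBU_crownWithApexes hG

theorem dCBUGraphs_ne {d e : ℕ} (hd : 2 ≤ d) (he : 2 ≤ e) (hde : d ≠ e) :
    dCBUGraphs d ≠ dCBUGraphs e := by
  rcases lt_or_gt_of_ne hde with h | h
  · exact dCBUGraphs_ne_of_lt hd h
  · exact (dCBUGraphs_ne_of_lt he h).symm

/-! ### Three-dimensional CBU graphs of large chromatic number -/

/-- A digraph `Arc` on `V` with a family of vertex sets `A p`, indexed by `P`, called probes. -/
structure ProbedDigraph where
  V : Type
  P : Type
  finV : Finite V
  finP : Finite P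
  Arc : V → V → Prop
  A : P → Set V

namespace ProbedDigraph

attribute [instance] finV finP

/-- In every proper colouring some probe receives at least `k` colours. -/
def Sees (D : ProbedDigraph) (k : ℕ) : Prop :=
  ∀ (C : Type) (c : D.V → C), (∀ u v, D.Arc u v → c u ≠ c v) → ∃ p, k ≤ (c '' D.A p).ncard

/-- A drawing of the line digraph of `D` in the box `[t₀, t₁] × [x₀, x₁] × [y₀, y₁]`: the arc `u v`
becomes the box `[time u, time v] × R u v`, and these boxes meet exactly when the arcs are
consecutive. Moreover the probes have disjoint strips `lo p ≤ y ≤ hi p`, and every vertex `v` of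
the probe `p` has an interval `[l p v, r p v]` for which a further arc that leaves `v` towards a
new vertex, later than all the others, can be drawn as `[l p v, r p v] × J` with any interval `J`
in the strip of `p`. -/
structure Drawing (D : ProbedDigraph) (x₀ x₁ y₀ y₁ t₀ t₁ : ℝ) where
  time : D.V → ℝ
  R : D.V → D.V → Frame
  lo : D.P → ℝ
  hi : D.P → ℝ
  l : D.P → D.V → ℝ
  r : D.P → D.V → ℝ
  time_mem : ∀ v, t₀ < time v ∧ time v < t₁
  R_mem : ∀ u v, D.Arc u v →
    x₀ ≤ (R u v).x₁ ∧ (R u v).x₂ ≤ x₁ ∧ y₀ ≤ (R u v).y₁ ∧ (R u v).y₂ ≤ y₁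
  time_lt : ∀ u v, D.Arc u v → time u < time v
  meet : ∀ u v w, D.Arc u v → D.Arc v w → ¬ (R u v).Apart (R v w)
  apart : ∀ u v u' v', D.Arc u v → D.Arc u' v' → (u = u' → v ≠ v') → v ≠ u' → v' ≠ u →
    time u ≤ time v' → time u' ≤ time v → (R u v).Apart (R u' v')
  strip : ∀ p, y₀ ≤ lo p ∧ lo p < hi p ∧ hi p ≤ y₁
  strip_disjoint : ∀ p q, p ≠ q → hi p < lo q ∨ hi q < lo p
  l_lt_r : ∀ p v, l p v < r p v
  lr_mem : ∀ p, ∀ v ∈ D.A p, x₀ ≤ l p v ∧ r p v ≤ x₁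
  lr_disjoint : ∀ p, ∀ v ∈ D.A p, ∀ w ∈ D.A p, v ≠ w → r p v < l p w ∨ r p w < l p v
  access : ∀ p, ∀ v ∈ D.A p, ∀ u, D.Arc u v →
    (R u v).y₁ ≤ lo p ∧ hi p ≤ (R u v).y₂ ∧ (R u v).x₁ ≤ r p v ∧ l p v ≤ (R u v).x₂
  free : ∀ p, ∀ v ∈ D.A p, ∀ u w, D.Arc u w → w ≠ v → time v ≤ time w →
    r p v < (R u w).x₁ ∨ (R u w).x₂ < l p v ∨ hi p < (R u w).y₁ ∨ (R u w).y₂ < lo p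

/-- The line digraph of `D` can be drawn in every box. -/
def Drawable (D : ProbedDigraph) : Prop :=
  ∀ x₀ x₁ y₀ y₁ t₀ t₁ : ℝ, x₀ < x₁ → y₀ < y₁ → t₀ < t₁ → Nonempty (D.Drawing x₀ x₁ y₀ y₁ t₀ t₁)

/-- No vertices and one empty probe. -/
def empty : ProbedDigraph where
  V := Empty
  P := Unit
  finV := inferInstance
  finP := inferInstance
  Arc _ _ := False
  A _ := ∅

/-- The arcs of `D.next`: those of the outer copy, those of the inner copies, which are indexed by
the probes `p`, and those towards the new vertex `(p, q)` from the vertices of the probe `q` of the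
inner copy `p`. -/
inductive NextArc (D : ProbedDigraph) : D.V ⊕ D.P × (D.V ⊕ D.P) → D.V ⊕ D.P × (D.V ⊕ D.P) → Prop
  | outer {u v : D.V} (h : D.Arc u v) : NextArc D (.inl u) (.inl v)
  | inner (p : D.P) {u v : D.V} (h : D.Arc u v) : NextArc D (.inr (p, .inl u)) (.inr (p, .inl v))
  | diag (p q : D.P) {v : D.V} (h : v ∈ D.A q) : NextArc D (.inr (p, .inl v)) (.inr (p, .inr q))

/-- Burling's construction: for every probe `p` there is an inner copy of `D`, and for every probe
`q` of this inner copy a new vertex with an arc from each vertex of `q`. The pair `p, q` gives two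
probes: `p` together with `q`, and `p` together with the new vertex. -/
def next (D : ProbedDigraph) : ProbedDigraph where
  V := D.V ⊕ D.P × (D.V ⊕ D.P)
  P := (D.P × D.P) × Bool
  finV := inferInstance
  finP := inferInstance
  Arc := D.NextArc
  A s := Sum.inl '' D.A s.1.1 ∪
    if s.2 then (fun v => .inr (s.1.1, .inl v)) '' D.A s.1.2 else {.inr (s.1.1, .inr s.1.2)}

theorem mem_next_A {D : ProbedDigraph} {p q : D.P} {b : Bool}
    {v : D.V ⊕ D.P × (D.V ⊕ D.P)} : v ∈ D.next.A ((p, q), b) ↔ (∃ w ∈ D.A p, v = .inl w) ∨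
      (b = true ∧ ∃ w ∈ D.A q, v = .inr (p, .inl w)) ∨ (b = false ∧ v = .inr (p, .inr q)) := by
  cases b
  · change v ∈ Sum.inl '' D.A p ∪ {.inr (p, .inr q)} ↔ _
    simp [eq_comm, or_comm]
  · change v ∈ Sum.inl '' D.A p ∪ (fun v => .inr (p, .inl v)) '' D.A q ↔ _
    simp [eq_comm]

/-- If the inner probe `q` repeats only colours of `p`, then either `q` misses one of them or the
new vertex above `q` has a colour that `p` lacks. -/
theorem Sees.next {D : ProbedDigraph} {k : ℕ} (h : D.Sees k) : D.next.Sees (k + 1) := by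
  intro C (c : D.V ⊕ D.P × (D.V ⊕ D.P) → C) hc
  obtain ⟨p, hp⟩ := h C (fun v => c (.inl v)) fun u v huv => hc _ _ (.outer huv)
  obtain ⟨q, hq⟩ := h C (fun v => c (.inr (p, .inl v))) fun u v huv => hc _ _ (.inner p huv)
  set K := (fun v => c (.inl v)) '' D.A p with hK
  set L := (fun v => c (.inr (p, .inl v))) '' D.A q with hL
  have hKf : K.Finite := (Set.toFinite _).image _
  have hLf : L.Finite := (Set.toFinite _).image _
  by_cases hLK : L ⊆ K
  · refine ⟨((p, q), false), ?_⟩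
    have himg : c '' D.next.A ((p, q), false) = insert (c (.inr (p, .inr q))) K := by
      change c '' (Sum.inl '' D.A p ∪ {.inr (p, .inr q)}) = _
      rw [Set.union_singleton, Set.image_insert_eq, Set.image_image]
    refine le_of_le_of_eq ?_ (congrArg Set.ncard himg.symm)
    by_cases hd : c (.inr (p, .inr q)) ∈ K
    · -- The colour of the new vertex is missing in `L`, so `K` is larger than `L`.
      rw [Set.insert_eq_of_mem hd]
      have hne : L ⊂ K := by
        refine hLK.ssubset_of_ne fun heq => ?_
        rw [← heq] at hd
        obtain ⟨v, hv, hvd⟩ := hd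
        exact hc _ _ (.diag p q hv) hvd
      exact (Nat.succ_le_succ hq).trans (Set.ncard_lt_ncard hne hKf)
    · rw [Set.ncard_insert_of_notMem hd hKf]
      exact Nat.succ_le_succ hp
  · refine ⟨((p, q), true), ?_⟩
    have himg : c '' D.next.A ((p, q), true) = K ∪ L := by
      change c '' (Sum.inl '' D.A p ∪ (fun v => .inr (p, .inl v)) '' D.A q) = _
      rw [Set.image_union, Set.image_image, Set.image_image]
    refine le_of_le_of_eq ?_ (congrArg Set.ncard himg.symm)
    have hne : K ⊂ K ∪ L := by
      refine Set.subset_union_left.ssubset_of_ne fun heq => hLK ?_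
      rw [heq]
      exact Set.subset_union_right
    exact (Nat.succ_le_succ hp).trans (Set.ncard_lt_ncard hne (hKf.union hLf))

section NextDrawing

variable {D : ProbedDigraph} {x₀ xa xb x₁ y₀ y₁ t₀ ta tb t₁ : ℝ}
  (O : D.Drawing x₀ xa y₀ y₁ t₀ ta) (I : ∀ p, D.Drawing xb x₁ (O.lo p) (O.hi p) ta tb)

/-- The drawing of `D.next`: the inner copy of the probe `p` is drawn in the strip of `p`, to the
right of and later than the outer copy; the strip of each of its probes `q` is divided into a lower
third, for the probe `p` with `q`, and an upper third, for the new vertex. -/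
noncomputable def Drawing.next (hx : x₀ ≤ xa) (hxab : xa < xb) (hxb : xb < x₁) (ht : t₀ < ta)
    (htb : ta < tb) (htb' : tb < t₁) : D.next.Drawing x₀ x₁ y₀ y₁ t₀ t₁ where
  time
    | .inl v => O.time v
    | .inr (p, .inl v) => (I p).time v
    | .inr (_, .inr _) => tb
  R
    | .inl u, .inl v => O.R u v
    | .inr (p, .inl u), .inr (_, .inl v) => (I p).R u v
    | .inr (p, .inl u), .inr (_, .inr q) =>
      { x₁ := (I p).l q u
        x₂ := (I p).r q u
        y₁ := (I p).lo q + 2 * ((I p).hi q - (I p).lo q) / 3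
        y₂ := (I p).hi q
        hx := (I p).l_lt_r q u
        hy := by linarith [((I p).strip q).2.1] }
    | _, _ => ⟨0, 1, 0, 1, one_pos, one_pos⟩
  lo
    | ((p, q), true) => (I p).lo q
    | ((p, q), false) => (I p).lo q + 2 * ((I p).hi q - (I p).lo q) / 3
  hi
    | ((p, q), true) => (I p).lo q + ((I p).hi q - (I p).lo q) / 3
    | ((p, q), false) => (I p).hi q
  l
    | ((p, _), _), .inl v => O.l p v
    | ((p, q), _), .inr (_, .inl v) => (I p).l q v
    | _, .inr (_, .inr _) => xb
  r
    | ((p, _), _), .inl v => O.r p v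
    | ((p, q), _), .inr (_, .inl v) => (I p).r q v
    | _, .inr (_, .inr _) => x₁
  time_mem := by
    rintro (v | ⟨p, v | q⟩)
    · have := O.time_mem v
      exact ⟨this.1, by dsimp only; linarith⟩
    · have := (I p).time_mem v
      constructor <;> dsimp only <;> linarith
    · constructor <;> dsimp only <;> linarith
  R_mem := by
    rintro _ _ (⟨h⟩ | ⟨p, h⟩ | ⟨p, q, h⟩)
    · obtain ⟨h1, h2, h3, h4⟩ := O.R_mem _ _ h
      refine ⟨h1, ?_, h3, h4⟩
      dsimp only; linarith
    · obtain ⟨h1, h2, h3, h4⟩ := (I p).R_mem _ _ h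
      obtain ⟨h5, h6, h7⟩ := O.strip p
      refine ⟨?_, h2, h5.trans h3, h4.trans h7⟩
      dsimp only; linarith
    · obtain ⟨h1, h2⟩ := (I p).lr_mem _ _ h
      obtain ⟨h5, h6, h7⟩ := O.strip p
      obtain ⟨h8, h9, h10⟩ := (I p).strip q
      refine ⟨?_, h2, ?_, h10.trans h7⟩ <;> dsimp only <;> linarith
  time_lt := by
    rintro _ _ (⟨h⟩ | ⟨p, h⟩ | ⟨p, q, h⟩)
    · exact O.time_lt _ _ h
    · exact (I p).time_lt _ _ h
    · exact ((I p).time_mem _).2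
  meet := by
    rintro _ _ _ (⟨h⟩ | ⟨p, h⟩ | ⟨p, q, h⟩) (⟨h'⟩ | ⟨_, h'⟩ | ⟨_, q', h'⟩)
    · exact O.meet _ _ _ h h'
    · exact (I p).meet _ _ _ h h'
    · obtain ⟨h1, h2, h3, h4⟩ := (I p).access _ _ h' _ h
      have := ((I p).strip q').2.1
      rintro (h5 | h5 | h5 | h5) <;> dsimp only at h5 <;> linarith
  apart := by
    have hsep : ∀ p p' (F G : Frame), p ≠ p' → O.lo p ≤ F.y₁ → F.y₂ ≤ O.hi p → O.lo p' ≤ G.y₁ →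
        G.y₂ ≤ O.hi p' → F.Apart G := by
      intro p p' F G hne h1 h2 h3 h4
      rcases O.strip_disjoint p p' hne with h | h
      · exact Or.inr (Or.inr (Or.inl (by linarith)))
      · exact Or.inr (Or.inr (Or.inr (by linarith)))
    have hsymm : ∀ F G : Frame, F.Apart G → G.Apart F := by
      rintro F G (h | h | h | h)
      exacts [Or.inr (Or.inl h), Or.inl h, Or.inr (Or.inr (Or.inr h)), Or.inr (Or.inr (Or.inl h))]
    have hdiag : ∀ (p p' q' : D.P) (u v v' : D.V), D.Arc u v → v' ∈ D.A q' →
        (Sum.inr (p, Sum.inl v) : D.V ⊕ D.P × (D.V ⊕ D.P)) ≠ .inr (p', .inl v') →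
        (I p').time v' ≤ (I p).time v → ((I p).R u v).Apart
          { x₁ := (I p').l q' v'
            x₂ := (I p').r q' v'
            y₁ := (I p').lo q' + 2 * ((I p').hi q' - (I p').lo q') / 3
            y₂ := (I p').hi q'
            hx := (I p').l_lt_r q' v'
            hy := by linarith [((I p').strip q').2.1] } := by
      intro p p' q' u v v' h h' hne hle
      have b := (I p').strip q'
      by_cases hp : p = p'
      · subst hp
        rcases (I p).free q' v' h' u v h (fun e => hne (e ▸ rfl)) hle with hd | hd | hd | hd
        · exact Or.inr (Or.inl hd)
        · exact Or.inl hd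
        · exact Or.inr (Or.inr (Or.inr hd))
        · right; right; left; dsimp only; linarith
      · obtain ⟨-, -, a3, a4⟩ := (I p).R_mem _ _ h
        refine hsep p p' _ _ hp a3 a4 ?_ b.2.2
        dsimp only; linarith
    rintro _ _ _ _ (⟨h⟩ | ⟨p, h⟩ | @⟨p, q, v, h⟩) (⟨h'⟩ | ⟨p', h'⟩ | @⟨p', q', v', h'⟩)
      h1 h2 h3 h4 h5
    · exact O.apart _ _ _ _ h h' (fun e e' => h1 (congrArg _ e) (congrArg _ e'))
        (fun e => h2 (congrArg _ e)) (fun e => h3 (congrArg _ e)) h4 h5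
    · exact absurd (h5.trans_lt (O.time_mem _).2) ((I p').time_mem _).1.not_gt
    · exact absurd (h5.trans_lt (O.time_mem _).2) ((I p').time_mem _).1.not_gt
    · exact absurd (h4.trans_lt (O.time_mem _).2) ((I p).time_mem _).1.not_gt
    · by_cases hp : p = p'
      · subst hp
        exact (I p).apart _ _ _ _ h h' (fun e e' => h1 (e ▸ rfl) (e' ▸ rfl))
          (fun e => h2 (e ▸ rfl)) (fun e => h3 (e ▸ rfl)) h4 h5
      · obtain ⟨-, -, a3, a4⟩ := (I p).R_mem _ _ h
        obtain ⟨-, -, b3, b4⟩ := (I p').R_mem _ _ h'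
        exact hsep p p' _ _ hp a3 a4 b3 b4
    · exact hdiag p p' q' _ _ _ h h' (fun e => h2 e) h5
    · exact absurd (h4.trans_lt (O.time_mem _).2) ((I p).time_mem _).1.not_gt
    · exact hsymm _ _ (hdiag p' p q _ _ _ h' h (fun e => h3 e) h4)
    · have a := (I p).strip q
      have b := (I p').strip q'
      by_cases hp : p = p'
      · subst hp
        by_cases hq : q = q'
        · subst hq
          rcases (I p).lr_disjoint q v h v' h' (fun e => h1 (e ▸ rfl) rfl) with hd | hd
          · exact Or.inl hd
          · exact Or.inr (Or.inl hd)
        · rcases (I p).strip_disjoint q q' hq with hd | hd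
          · right; right; left; dsimp only; linarith
          · right; right; right; dsimp only; linarith
      · refine hsep p p' _ _ hp ?_ a.2.2 ?_ b.2.2 <;> dsimp only <;> linarith
  strip := by
    rintro ⟨⟨p, q⟩, _ | _⟩ <;>
    · obtain ⟨h5, h6, h7⟩ := O.strip p
      obtain ⟨h8, h9, h10⟩ := (I p).strip q
      refine ⟨?_, ?_, ?_⟩ <;> dsimp only <;> linarith
  strip_disjoint := by
    rintro ⟨⟨p, q⟩, b⟩ ⟨⟨p', q'⟩, b'⟩ hne
    have h1 := (I p).strip q
    have h2 := (I p').strip q'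
    have key : (I p).hi q < (I p').lo q' ∨ (I p').hi q' < (I p).lo q ∨ (p = p' ∧ q = q') := by
      by_cases hp : p = p'
      · subst hp
        by_cases hq : q = q'
        · exact Or.inr (Or.inr ⟨rfl, hq⟩)
        · exact ((I p).strip_disjoint q q' hq).imp_right Or.inl
      · rcases O.strip_disjoint p p' hp with h | h
        · left; linarith
        · right; left; linarith
    rcases key with h | h | ⟨rfl, rfl⟩
    · left; cases b <;> cases b' <;> dsimp only <;> linarith
    · right; cases b <;> cases b' <;> dsimp only <;> linarith
    · cases b <;> cases b'
      · exact absurd rfl hne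
      · right; dsimp only; linarith
      · left; dsimp only; linarith
      · exact absurd rfl hne
  l_lt_r := by
    rintro ⟨⟨p, q⟩, b⟩ (v | ⟨p', v | q'⟩)
    · exact O.l_lt_r _ _
    · exact (I p).l_lt_r _ _
    · exact hxb
  lr_mem := by
    rintro ⟨⟨p, q⟩, b⟩ v hv
    rcases mem_next_A.1 hv with ⟨v, hv', rfl⟩ | ⟨rfl, v, hv', rfl⟩ | ⟨rfl, rfl⟩
    · have := O.lr_mem p v hv'
      constructor <;> dsimp only <;> linarith
    · have := (I p).lr_mem q v hv'
      constructor <;> dsimp only <;> linarith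
    · constructor <;> dsimp only <;> linarith
  lr_disjoint := by
    rintro ⟨⟨p, q⟩, b⟩ v hv w hw hne
    rcases mem_next_A.1 hv with ⟨v, hv', rfl⟩ | ⟨rfl, v, hv', rfl⟩ | ⟨rfl, rfl⟩ <;>
    rcases mem_next_A.1 hw with ⟨w, hw', rfl⟩ | ⟨hb, w, hw', rfl⟩ | ⟨hb, rfl⟩
    · exact O.lr_disjoint p v hv' w hw' fun h => hne (h ▸ rfl)
    · have h1 := O.lr_mem p v hv'
      have h2 := (I p).lr_mem q w hw'
      left; dsimp only; linarith
    · have h1 := O.lr_mem p v hv'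
      left; dsimp only; linarith
    · have h1 := O.lr_mem p w hw'
      have h2 := (I p).lr_mem q v hv'
      right; dsimp only; linarith
    · exact (I p).lr_disjoint q v hv' w hw' fun h => hne (h ▸ rfl)
    · simp at hb
    · have h1 := O.lr_mem p w hw'
      right; dsimp only; linarith
    · simp at hb
    · exact absurd rfl hne
  access := by
    rintro ⟨⟨p, q⟩, b⟩ _ hv _ (⟨h⟩ | ⟨p', h⟩ | ⟨p', q', h⟩) <;>
    have hs := (I p).strip q <;>
    rcases mem_next_A.1 hv with ⟨w, hw, e⟩ | ⟨rfl, w, hw, e⟩ | ⟨rfl, e⟩ <;> cases e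
    · obtain ⟨h1, h2, h3, h4⟩ := O.access p _ hw _ h
      refine ⟨?_, ?_, h3, h4⟩ <;> cases b <;> dsimp only <;> linarith
    · obtain ⟨h1, h2, h3, h4⟩ := (I p).access q _ hw _ h
      refine ⟨h1, ?_, h3, h4⟩
      dsimp only; linarith
    · have h1 := (I p).lr_mem q _ h
      have h2 := (I p).l_lt_r q
      refine ⟨le_rfl, le_rfl, ?_, ?_⟩ <;> dsimp only
      · exact (h2 _).le.trans h1.2
      · exact h1.1.trans (h2 _).le
  free := by
    have hsep : ∀ p q p' q', ¬ (p = p' ∧ q = q') →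
        (I p).hi q < (I p').lo q' ∨ (I p').hi q' < (I p).lo q := by
      intro p q p' q' hne
      have h1 := (I p).strip q
      have h2 := (I p').strip q'
      by_cases hp : p = p'
      · subst hp
        exact (I p).strip_disjoint q q' fun hq => hne ⟨rfl, hq⟩
      · rcases O.strip_disjoint p p' hp with h | h
        · left; linarith
        · right; linarith
    rintro ⟨⟨p, q⟩, b⟩ _ hv _ _ (⟨h⟩ | ⟨p', h⟩ | ⟨p', q', h⟩) hne hle <;>
    have hs := (I p).strip q <;>
    rcases mem_next_A.1 hv with ⟨w, hw, rfl⟩ | ⟨rfl, w, hw, rfl⟩ | ⟨rfl, rfl⟩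
    · rcases O.free p w hw _ _ h (fun e => hne (congrArg _ e)) hle with hd | hd | hd | hd
      · exact Or.inl hd
      · exact Or.inr (Or.inl hd)
      · right; right; left; cases b <;> dsimp only <;> linarith
      · right; right; right; cases b <;> dsimp only <;> linarith
    · exact absurd (hle.trans_lt (O.time_mem _).2) ((I p).time_mem _).1.not_gt
    · exact absurd (hle.trans_lt (O.time_mem _).2) htb.not_gt
    · have h1 := (O.lr_mem p w hw).2
      have h2 := ((I p').R_mem _ _ h).1
      left; dsimp only; linarith
    · have hR := (I p').R_mem _ _ h
      by_cases hp : p = p'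
      · subst hp
        rcases (I p).free q w hw _ _ h (fun e => hne (e ▸ rfl)) hle with hd | hd | hd | hd
        · exact Or.inl hd
        · exact Or.inr (Or.inl hd)
        · right; right; left; dsimp only; linarith
        · exact Or.inr (Or.inr (Or.inr hd))
      · rcases O.strip_disjoint p p' hp with hd | hd
        · right; right; left; dsimp only; linarith
        · right; right; right; dsimp only; linarith
    · exact absurd (hle.trans_lt ((I p').time_mem _).2) (lt_irrefl _)
    · have h1 := (O.lr_mem p w hw).2
      have h2 := ((I p').lr_mem _ _ h).1
      left; dsimp only; linarith
    · have hs' := (I p').strip q'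
      by_cases hpq : p = p' ∧ q = q'
      · obtain ⟨rfl, rfl⟩ := hpq
        right; right; left; dsimp only; linarith
      · rcases hsep p q p' q' hpq with hd | hd
        · right; right; left; dsimp only; linarith
        · right; right; right; dsimp only; linarith
    · have hs' := (I p').strip q'
      rcases hsep p q p' q' (fun e => hne (by rw [e.1, e.2])) with hd | hd
      · right; right; left; dsimp only; linarith
      · right; right; right; dsimp only; linarith

end NextDrawing

theorem Drawable.next {D : ProbedDigraph} (h : D.Drawable) : D.next.Drawable := by
  intro x₀ x₁ y₀ y₁ t₀ t₁ hx hy ht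
  obtain ⟨O⟩ := h x₀ (x₀ + (x₁ - x₀) / 3) y₀ y₁ t₀ (t₀ + (t₁ - t₀) / 3) (by linarith) hy
    (by linarith)
  have I : ∀ p, Nonempty (D.Drawing (x₀ + 2 * (x₁ - x₀) / 3) x₁ (O.lo p) (O.hi p)
      (t₀ + (t₁ - t₀) / 3) (t₀ + 2 * (t₁ - t₀) / 3)) := fun p =>
    h _ _ _ _ _ _ (by linarith) (O.strip p).2.1 (by linarith)
  exact ⟨O.next (fun p => (I p).some) (by linarith) (by linarith) (by linarith) (by linarith)
    (by linarith) (by linarith)⟩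

theorem sees_empty : empty.Sees 0 := fun _ _ _ => ⟨(), Nat.zero_le _⟩

theorem drawable_empty : empty.Drawable := by
  intro x₀ x₁ y₀ y₁ t₀ t₁ hx hy ht
  exact ⟨{
    time := Empty.elim
    R := fun u => u.elim
    lo := fun _ => y₀
    hi := fun _ => y₁
    l := fun _ => Empty.elim
    r := fun _ => Empty.elim
    time_mem := fun u => u.elim
    R_mem := fun u => u.elim
    time_lt := fun u => u.elim
    meet := fun u => u.elim
    apart := fun u => u.elim
    strip := fun _ => ⟨le_rfl, hy, le_rfl⟩
    strip_disjoint := fun p q h => absurd rfl h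
    l_lt_r := fun _ u => u.elim
    lr_mem := fun _ u => u.elim
    lr_disjoint := fun _ u => u.elim
    access := fun _ u => u.elim
    free := fun _ u => u.elim }⟩

theorem exists_drawable_sees (k : ℕ) : ∃ D : ProbedDigraph, D.Drawable ∧ D.Sees k := by
  induction k with
  | zero => exact ⟨empty, drawable_empty, sees_empty⟩
  | succ k ih =>
    obtain ⟨D, h, h'⟩ := ih
    exact ⟨D.next, h.next, h'.next⟩

/-- The arcs of `D`, two arcs being adjacent when they are consecutive. -/
def lineGraph (D : ProbedDigraph) : SimpleGraph {e : D.V × D.V // D.Arc e.1 e.2} :=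
  SimpleGraph.fromRel fun e f => e.1.2 = f.1.1

/-- Colouring a vertex by the set of the colours of the arcs that leave it turns a proper colouring
of the line graph with `n` colours into one of the digraph with `2 ^ n` colours. -/
theorem Sees.not_colorable_lineGraph {D : ProbedDigraph} {n : ℕ} (h : D.Sees (2 ^ n + 1))
    (hirr : ∀ v, ¬ D.Arc v v) :
    ¬ D.lineGraph.Colorable n := by
  rintro ⟨c⟩
  obtain ⟨p, hp⟩ := h (Set (Fin n)) (fun v => {x | ∃ w, ∃ h : D.Arc v w, c ⟨(v, w), h⟩ = x})
    fun u v huv heq => by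
      have hmem : c ⟨(u, v), huv⟩ ∈ {x | ∃ w, ∃ h : D.Arc v w, c ⟨(v, w), h⟩ = x} :=
        heq ▸ ⟨v, huv, rfl⟩
      obtain ⟨w, hvw, hw⟩ := hmem
      by_cases he : (⟨(u, v), huv⟩ : {e : D.V × D.V // D.Arc e.1 e.2}) = ⟨(v, w), hvw⟩
      · have hu : u = v := congrArg (fun e => e.1.1) he
        exact hirr v (by rwa [hu] at huv)
      · exact c.valid ((SimpleGraph.fromRel_adj _ _ _).2 ⟨he, Or.inl rfl⟩) hw.symm
  have := hp.trans (Set.ncard_le_card _)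
  simp at this

theorem Drawing.isDCBU_lineGraph {D : ProbedDigraph} {x₀ x₁ y₀ y₁ t₀ t₁ : ℝ}
    (S : D.Drawing x₀ x₁ y₀ y₁ t₀ t₁) : IsDCBU 3 D.lineGraph := by
  refine isDCBU_iff.2 ⟨three_pos, fun e =>
    ⟨![S.time e.1.1, (S.R e.1.1 e.1.2).x₁, (S.R e.1.1 e.1.2).y₁],
     ![S.time e.1.2, (S.R e.1.1 e.1.2).x₂, (S.R e.1.1 e.1.2).y₂], fun i => ?_⟩, ?_, ?_⟩
  · fin_cases i
    exacts [S.time_lt _ _ e.2, (S.R _ _).hx, (S.R _ _).hy]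
  · rintro ⟨⟨u, v⟩, h⟩ ⟨⟨u', v'⟩, h'⟩ hne
    have ht := S.time_lt _ _ h
    have ht' := S.time_lt _ _ h'
    dsimp only at h h' ht ht'
    simp only [lineGraph, SimpleGraph.fromRel_adj, ne_eq, hne, not_false_eq_true, true_and,
      Fin.forall_fin_succ, Matrix.cons_val_zero, Matrix.cons_val_succ, IsEmpty.forall_iff, and_true]
    constructor
    · rintro (rfl | rfl)
      · have := S.meet _ _ _ h h'
        simp only [Frame.Apart, not_or, not_lt] at this
        refine ⟨⟨?_, ?_⟩, ⟨?_, ?_⟩, ?_, ?_⟩ <;> linarith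
      · have := S.meet _ _ _ h' h
        simp only [Frame.Apart, not_or, not_lt] at this
        refine ⟨⟨?_, ?_⟩, ⟨?_, ?_⟩, ?_, ?_⟩ <;> linarith
    · rintro ⟨⟨h1, h2⟩, ⟨h3, h4⟩, h5, h6⟩
      by_contra! hc
      rcases S.apart u v u' v' h h' (fun e e' => hne (by subst e; subst e'; rfl)) hc.1 hc.2 h1 h2
        with hd | hd | hd | hd <;> linarith
  · rintro ⟨⟨u, v⟩, h⟩ ⟨⟨u', v'⟩, h'⟩ hadj
    rcases ((SimpleGraph.fromRel_adj _ _ _).1 hadj).2 with he | he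
    · exact Or.inl (congrArg S.time he)
    · exact Or.inr (congrArg S.time he)

end ProbedDigraph

theorem exists_isDCBU_three_not_colorable (n : ℕ) :
    ∃ G : FiniteGraph, IsDCBU 3 G.graph ∧ ¬ G.graph.Colorable n := by
  obtain ⟨D, h, h'⟩ := ProbedDigraph.exists_drawable_sees (2 ^ n + 1)
  obtain ⟨S⟩ := h 0 1 0 1 0 1 one_pos one_pos one_pos
  exact ⟨⟨_, inferInstance, D.lineGraph⟩, S.isDCBU_lineGraph, 
    h'.not_colorable_lineGraph fun v hv => (S.time_lt v v hv).false⟩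

theorem isChiUnbounded_dCBUGraphs {d : ℕ} (hd : 3 ≤ d) : IsChiUnbounded (dCBUGraphs d) := by
  rintro ⟨f, hf⟩
  obtain ⟨G, hG, hcol⟩ := exists_isDCBU_three_not_colorable (f 0 + f 1 + f 2)
  have := G.finite
  refine hcol (SimpleGraph.chromaticNumber_le_iff_colorable.1
    ((hf G (hG.mono hd)).trans (Nat.cast_le.2 ?_)))
  have hω : G.graph.cliqueNum < 3 := by
    by_contra! hle
    obtain ⟨s, hs⟩ := G.graph.exists_isNClique_cliqueNum
    exact hG.cliqueFree_three.mono hle s hs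
  interval_cases G.graph.cliqueNum <;> omega

/-! ### Classes incomparable with the Burling graphs -/

theorem not_burlingGraphs_subset_dCBUGraphs (d : ℕ) : ¬ burlingGraphs ⊆ dCBUGraphs d := fun h =>
  not_isDCBU_burlingGraphNotCBU d
    (h (show (⟨_, inferInstance, burlingGraphNotCBU⟩ : FiniteGraph) ∈ burlingGraphs from
      isBurling_burlingGraphNotCBU))

theorem not_dCBUGraphs_subset_burlingGraphs {d : ℕ} (hd : 2 ≤ d) :
    ¬ dCBUGraphs d ⊆ burlingGraphs := fun h =>
  not_isBurling_cubeMinusVertex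
    (h (show (⟨_, inferInstance, cubeMinusVertex⟩ : FiniteGraph) ∈ dCBUGraphs d from
      isDCBU_cubeMinusVertex.mono hd))

theorem theorem1 :
    (∀ d : ℕ, 3 ≤ d →
      IsGeometricClass (dCBUGraphs d) ∧ IsHereditary (dCBUGraphs d) ∧
      IsTriangleFreeClass (dCBUGraphs d) ∧ IsChiUnbounded (dCBUGraphs d) ∧
      ¬ burlingGraphs ⊆ dCBUGraphs d ∧ ¬ dCBUGraphs d ⊆ burlingGraphs) ∧
    (∃ G₁ : FiniteGraph, IsWheel G₁.graph ∧ G₁ ∈ dCBUGraphs 2 ∧ G₁ ∉ burlingGraphs) ∧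
    (∃ G₂ : FiniteGraph, G₂ ∈ burlingGraphs ∧ G₂ ∉ CBUGraphs) ∧
    (∀ d d' : ℕ, 3 ≤ d → 3 ≤ d' → d ≠ d' → dCBUGraphs d ≠ dCBUGraphs d') ∧
    {C : GraphClass | IsGeometricClass C ∧ IsHereditary C ∧ IsTriangleFreeClass C ∧
      IsChiUnbounded C ∧ ¬ burlingGraphs ⊆ C ∧ ¬ C ⊆ burlingGraphs}.Infinite := by
  have main : ∀ d : ℕ, 3 ≤ d →
      IsGeometricClass (dCBUGraphs d) ∧ IsHereditary (dCBUGraphs d) ∧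
      IsTriangleFreeClass (dCBUGraphs d) ∧ IsChiUnbounded (dCBUGraphs d) ∧
      ¬ burlingGraphs ⊆ dCBUGraphs d ∧ ¬ dCBUGraphs d ⊆ burlingGraphs := fun d hd =>
    ⟨isGeometricClass_dCBUGraphs d, isHereditary_dCBUGraphs d, isTriangleFreeClass_dCBUGraphs d,
      isChiUnbounded_dCBUGraphs hd, not_burlingGraphs_subset_dCBUGraphs d,
      not_dCBUGraphs_subset_burlingGraphs (by omega)⟩
  refine ⟨main, ⟨⟨_, inferInstance, cubeMinusVertex⟩, isWheel_cubeMinusVertex,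
    isDCBU_cubeMinusVertex, not_isBurling_cubeMinusVertex⟩,
    ⟨⟨_, inferInstance, burlingGraphNotCBU⟩, isBurling_burlingGraphNotCBU, ?_⟩,
    fun d d' hd hd' => dCBUGraphs_ne (by omega) (by omega), ?_⟩
  · rintro ⟨d, -, h⟩
    exact not_isDCBU_burlingGraphNotCBU d h
  · refine Set.infinite_of_injective_forall_mem (f := fun n : ℕ => dCBUGraphs (n + 3))
      (fun m n hmn => ?_) fun n => main (n + 3) (by omega)
    by_contra hne
    exact dCBUGraphs_ne (d := m + 3) (e := n + 3) (by omega) (by omega) (by omega) hmn
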